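/- Let $m\ge 2$ and let $C=C_1\cup\dots\cup C_m\subset\mathbb C^2$ be a reduced affine plane curve with $m$ irreducible components $C_i=\{f_i=0\}$ (the $f_i\in\mathbb C[x,y]$ irreducible and pairwise non-proportional). Let $U=\mathbb C^2\setminus C$, $u_0\in U$, $G=\pi_1(U,u_0)$, and let $H=\Gamma_0$ be the maximal torsion-free abelian quotient of $G$, that is, $G$ modulo $\{g: g^k\in[G,G]\text{ for some }k\ne 0\}$. Let $\mathrm{lk}_i:H\to\mathbb Z$ be induced by the linking number with $C_i$ (the winding number of $f_i\circ\alpha$ around $0$ for a loop $\alpha$), and $\psi=\sum_i \mathrm{lk}_i$. Through meridians of the components, $H\cong\mathbb Z^m$ and $\mathbb Z[H]\cong\mathbb Z[t_1^{\pm1},\dots,t_m^{\pm1}]$, where $h\in H$ corresponds to $t_1^{\mathrm{lk}_1(h)}\cdots t_m^{\mathrm{lk}_m(h)}$. * Let $\bar\Gamma_0=\ker\psi\subset\Gamma_0$, $S_0=\mathbb Z[\bar\Gamma_0]\setminus\{0\}$, $\mathbb K_0=\mathbb Z[\bar\Gamma_0]S_0^{-1}$ (a field) and $R_0=\mathbb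 Z[\Gamma_0]S_0^{-1}$. Define $\delta_0(C)=\dim_{\mathbb K_0}H_1(U;R_0)\in\mathbb N\cup\{\infty\}$, the homology being taken with coefficients in the local system given by $G\to\Gamma_0\subset R_0^\times$. * Let $A_G=H_1(U,u_0;\mathbb Z[H])$, with coefficients in the local system given by $G\to H$. For a finite presentation $\mathbb Z[H]^q\xrightarrow{\Phi}\mathbb Z[H]^n\to A_G\to 0$, let $E_1(A_G)$ be the ideal generated by the minors of size $n-1$ of $\Phi$ (it does not depend on the presentation; it is the whole ring if $n\le 1$ and $0$ if $n-1>q$). The multivariable Alexander polynomial $\Delta_C\in\mathbb Z[H]$ is a greatest common divisor of $E_1(A_G)$, i.e. a generator of the smallest principal ideal containing $E_1(A_G)$; it is defined up to a unit. * For a non-zero $q=\sum_k a_k t_1^{i^k_1}\cdots t_m^{i^k_m}$ with all $a_k\neq0$ and distinct exponents, let $\deg q=\max_k\sum_l i^k_l-\min_k\sum_l i^k_l$. If $\delta_0(C)$ is finite, then $$\delta_0(C)=\deg(\Delta_C).$$ -/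

import Mathlib

open scoped DirectSum

noncomputable section

namespace PlaneCurve

/-! ### Homology with coefficients in a rank one local system -/

section LocalSystem

variable {X : Type*} [TopologicalSpace X] {x₀ : X} {R : Type*} [CommRing R]

/-- The submodule of functions `s` on homotopy classes of paths from `x₀` to `x` such that
`s (g · p) = ρ g * s p` for every loop `g` at `x₀`. -/
def fibreSubmodule (ρ : FundamentalGroup X x₀ →* Rˣ) (x : X) :
    Submodule R (Path.Homotopic.Quotient x₀ x → R) where
  carrier := {s | ∀ (g : FundamentalGroup X x₀) (p : Path.Homotopic.Quotient x₀ x),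
    s ((FundamentalGroup.toPath g).trans p) = (ρ g : R) * s p}
  add_mem' := by
    intro s t hs ht g p
    simp only [Pi.add_apply, hs g p, ht g p, mul_add]
  zero_mem' := by
    intro g p
    simp
  smul_mem' := by
    intro c s hs g p
    simp only [Pi.smul_apply, smul_eq_mul, hs g p]
    ring

/-- The fibre at `x` of the rank one local system `L_ρ` on `X` with monodromy `ρ`. The value `s p`
of `s` is its parallel transport back to `x₀` along `p`, so that evaluation at any fixed `p`
identifies the fibre with `R`. -/
def Fibre (ρ : FundamentalGroup X x₀ →* Rˣ) (x : X) : Type _ := fibreSubmodule ρ x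

instance (ρ : FundamentalGroup X x₀ →* Rˣ) (x : X) : AddCommGroup (Fibre ρ x) :=
  inferInstanceAs (AddCommGroup (fibreSubmodule ρ x))

instance (ρ : FundamentalGroup X x₀ →* Rˣ) (x : X) : Module R (Fibre ρ x) :=
  inferInstanceAs (Module R (fibreSubmodule ρ x))

theorem trans_assoc {w x y z : X} (p : Path.Homotopic.Quotient w x)
    (q : Path.Homotopic.Quotient x y) (r : Path.Homotopic.Quotient y z) :
    (p.trans q).trans r = p.trans (q.trans r) := by
  have h (a b c d : FundamentalGroupoid X) (f : a ⟶ b) (g : b ⟶ c) (k : c ⟶ d) :=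
    CategoryTheory.Category.assoc f g k
  exact h ⟨w⟩ ⟨x⟩ ⟨y⟩ ⟨z⟩ p q r

/-- Parallel transport along a homotopy class of paths. -/
def transport (ρ : FundamentalGroup X x₀ →* Rˣ) {x y : X} (q : Path.Homotopic.Quotient x y) :
    Fibre ρ x →ₗ[R] Fibre ρ y where
  toFun s := ⟨fun p => s.1 (p.trans q.symm), by
    intro g p
    have h := s.2 g (p.trans q.symm)
    rwa [← trans_assoc] at h⟩
  map_add' _ _ := rfl
  map_smul' _ _ := rfl

/-- The standard `n`-simplex. -/
abbrev Simplex (n : ℕ) : Type := stdSimplex ℝ (Fin (n + 1))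

/-- The base vertex of the standard simplex. -/
abbrev baseVertex (n : ℕ) : Simplex n := stdSimplex.vertex (0 : Fin (n + 1))

/-- The inclusion of the face opposite to the `i`-th vertex. -/
def face (n : ℕ) (i : Fin (n + 2)) : C(Simplex n, Simplex (n + 1)) :=
  ⟨stdSimplex.map i.succAbove, stdSimplex.continuous_map _⟩

/-- The straight path between two points of a simplex. -/
def segmentPath {n : ℕ} (a b : Simplex n) : Path a b where
  toFun t := ⟨AffineMap.lineMap (k := ℝ) a.1 b.1 (t : ℝ),
    (convex_stdSimplex ℝ (Fin (n + 1))).lineMap_mem a.2 b.2 t.2⟩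
  continuous_toFun :=
    (AffineMap.lineMap_continuous.comp continuous_subtype_val).subtype_mk _
  source' := by
    apply Subtype.ext
    simp
  target' := by
    apply Subtype.ext
    simp

/-- Singular `n`-chains of `X` with coefficients in the local system with monodromy `ρ`: finite sums
of singular simplices `σ`, each with a coefficient in the fibre over `σ (e₀)`. -/
abbrev Chain (ρ : FundamentalGroup X x₀ →* Rˣ) (n : ℕ) : Type _ :=
  ⨁ σ : C(Simplex n, X), Fibre ρ (σ (baseVertex n))

open Classical in
/-- The singular boundary: `∑ (-1)^i` times the `i`-th face, the coefficient being carried from the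
base vertex of the simplex to the base vertex of its face (these differ only for `i = 0`). -/
def boundary (ρ : FundamentalGroup X x₀ →* Rˣ) (n : ℕ) : Chain ρ (n + 1) →ₗ[R] Chain ρ n :=
  DirectSum.toModule R _ _ fun σ : C(Simplex (n + 1), X) =>
    ∑ i : Fin (n + 2), ((-1 : R) ^ (i : ℕ)) •
      (DirectSum.lof R C(Simplex n, X) (fun τ => Fibre ρ (τ (baseVertex n))) (σ.comp (face n i)) ∘ₗ
        transport ρ (Path.Homotopic.Quotient.mk
          ((segmentPath (baseVertex (n + 1)) (face n i (baseVertex n))).map σ.continuous)))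

/-- The chains supported on singular simplices with values in `A`. -/
def chainsIn (ρ : FundamentalGroup X x₀ →* Rˣ) (A : Set X) (n : ℕ) : Submodule R (Chain ρ n) where
  carrier := {c | ∀ σ, c σ ≠ 0 → Set.range σ ⊆ A}
  add_mem' := by
    intro c d hc hd σ h
    by_cases h1 : c σ = 0
    · refine hd σ fun h2 => h ?_
      rw [DirectSum.add_apply, h1, h2, add_zero]
    · exact hc σ h1
  zero_mem' := by
    intro σ h
    exact absurd rfl h
  smul_mem' := by
    intro r c hc σ h
    refine hc σ fun h2 => h ?_
    rw [DirectSum.smul_apply, h2, smul_zero]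

/-- Relative `1`-cycles of `(X, A)`. -/
def relCycles (ρ : FundamentalGroup X x₀ →* Rˣ) (A : Set X) : Submodule R (Chain ρ 1) :=
  (chainsIn ρ A 0).comap (boundary ρ 0)

/-- Relative `1`-boundaries of `(X, A)`. -/
def relBoundaries (ρ : FundamentalGroup X x₀ →* Rˣ) (A : Set X) : Submodule R (Chain ρ 1) :=
  LinearMap.range (boundary ρ 1) ⊔ chainsIn ρ A 1

/-- `H₁(X, A; L_ρ)`, the first relative homology with coefficients in the local system. -/
abbrev relH1 (ρ : FundamentalGroup X x₀ →* Rˣ) (A : Set X) : Type _ :=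
  relCycles ρ A ⧸ (relBoundaries ρ A).submoduleOf (relCycles ρ A)

/-- `H₁(X; L_ρ)`. -/
abbrev H1 (ρ : FundamentalGroup X x₀ →* Rˣ) : Type _ := relH1 ρ (∅ : Set X)

end LocalSystem

/-! ### Elementary ideals -/

section ElementaryIdeal

variable {R : Type*} [CommRing R]

/-- `Φ : R^q → R^n` is a (finite) presentation matrix of the module `M`:
`R^q → R^n → M → 0` is exact for some `R^n → M`. -/
def IsPresentation {n q : ℕ} (Φ : Matrix (Fin n) (Fin q) R)
    (M : Type*) [AddCommGroup M] [Module R M] : Prop :=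
  ∃ π : (Fin n → R) →ₗ[R] M,
    Function.Surjective π ∧ LinearMap.ker π = LinearMap.range Φ.mulVecLin

/-- The ideal generated by the minors of size `n - i` of the `n × q` matrix `Φ`. A repeated row or
column contributes the minor `0`, so the ideal is `0` if `n - i > q`; it is `R` if `i ≥ n`. -/
def minorIdeal {n q : ℕ} (i : ℕ) (Φ : Matrix (Fin n) (Fin q) R) : Ideal R :=
  Ideal.span {d | ∃ (r : Fin (n - i) → Fin n) (c : Fin (n - i) → Fin q), d = (Φ.submatrix r c).det}

/-- `I` is the `i`-th elementary ideal of `M`. -/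
def IsElementaryIdeal (i : ℕ) (M : Type*) [AddCommGroup M] [Module R M] (I : Ideal R) : Prop :=
  ∃ (n q : ℕ) (Φ : Matrix (Fin n) (Fin q) R), IsPresentation Φ M ∧ I = minorIdeal i Φ

/-- `d` generates the smallest principal ideal containing `I`, that is, `d` is a greatest common
divisor of the elements of `I`. -/
def IsGcdOf (I : Ideal R) (d : R) : Prop :=
  I ≤ Ideal.span {d} ∧ ∀ e : R, I ≤ Ideal.span {e} → Ideal.span {d} ≤ Ideal.span {e}

end ElementaryIdeal

/-! ### The maximal torsion-free abelian quotient -/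

section FreeAb

variable (G : Type*) [Group G]

/-- The maximal torsion-free abelian quotient of `G`, i.e. `G` modulo the first term
`{g | g ^ k ∈ [G, G] for some k ≠ 0}` of its rational derived series. -/
abbrev FreeAb : Type _ := Abelianization G ⧸ CommGroup.torsion (Abelianization G)

/-- The projection of `G` onto its maximal torsion-free abelian quotient. -/
def toFreeAb : G →* FreeAb G :=
  (QuotientGroup.mk' (CommGroup.torsion (Abelianization G))).comp Abelianization.of

variable {G}

theorem toFreeAb_surjective : Function.Surjective (toFreeAb G) :=
  (QuotientGroup.mk'_surjective _).comp (QuotientGroup.mk'_surjective (commutator G))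

/-- The kernel of `G → FreeAb G` is the first term of the rational derived series. -/
theorem toFreeAb_eq_one_iff (g : G) :
    toFreeAb G g = 1 ↔ ∃ k : ℤ, k ≠ 0 ∧ g ^ k ∈ commutator G := by
  have h1 : toFreeAb G g = 1 ↔ IsOfFinOrder (Abelianization.of g) := by
    simp only [toFreeAb, MonoidHom.comp_apply, QuotientGroup.mk'_apply, QuotientGroup.eq_one_iff]
    exact Iff.rfl
  rw [h1, isOfFinOrder_iff_zpow_eq_one]
  refine exists_congr fun k => and_congr Iff.rfl ?_
  rw [← map_zpow, ← MonoidHom.mem_ker, Abelianization.ker_of]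

/-- A homomorphism to `ℤ` factors through the maximal torsion-free abelian quotient. -/
def liftFreeAb (φ : G →* Multiplicative ℤ) : FreeAb G →* Multiplicative ℤ :=
  QuotientGroup.lift _ (Abelianization.lift φ) (by
    intro a ha
    have h : IsOfFinOrder (Abelianization.lift φ a) := MonoidHom.isOfFinOrder _ ha
    exact (isOfFinOrder_iff_eq_one _).1 h)

@[simp]
theorem liftFreeAb_toFreeAb (φ : G →* Multiplicative ℤ) (g : G) :
    liftFreeAb φ (toFreeAb G g) = φ g := rfl

end FreeAb

/-! ### The localization of `ℤ[Γ]` attached to `ψ : Γ → ℤ` -/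

section Localized

variable {Γ : Type*} [CommGroup Γ] (ψ : Γ →* Multiplicative ℤ)

/-- The inclusion `ℤ[ker ψ] ⊆ ℤ[Γ]`. -/
def kerInclusion : MonoidAlgebra ℤ ψ.ker →+* MonoidAlgebra ℤ Γ :=
  MonoidAlgebra.mapDomainRingHom ℤ ψ.ker.subtype

/-- `𝕂`, the ring of quotients of `ℤ[ker ψ]`. -/
abbrev BaseField : Type _ := FractionRing (MonoidAlgebra ℤ ψ.ker)

/-- The multiplicative set `S` of non-zero-divisors of `ℤ[ker ψ]`, inside `ℤ[Γ]`.
(For `Γ` torsion-free `ℤ[ker ψ]` is a domain, and `S = ℤ[ker ψ] ∖ {0}`.) -/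
abbrev localizingSet : Submonoid (MonoidAlgebra ℤ Γ) :=
  (nonZeroDivisors (MonoidAlgebra ℤ ψ.ker)).map (kerInclusion ψ)

/-- The localization `ℤ[Γ] S⁻¹`. -/
abbrev LocalizedRing : Type _ := Localization (localizingSet ψ)

/-- The inclusion `𝕂 ⊆ ℤ[Γ] S⁻¹`. -/
def baseInclusion : BaseField ψ →+* LocalizedRing ψ :=
  IsLocalization.map (M := nonZeroDivisors (MonoidAlgebra ℤ ψ.ker)) (T := localizingSet ψ)
    (LocalizedRing ψ) (kerInclusion ψ) (Submonoid.le_comap_map _)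

/-- The dimension over `𝕂` of a module over `ℤ[Γ] S⁻¹`, in `ℕ ∪ {∞}`. -/
def rankOverBase (M : Type*) [AddCommGroup M] [Module (LocalizedRing ψ) M] : ℕ∞ :=
  letI : Module (BaseField ψ) M := Module.compHom M (baseInclusion ψ)
  Cardinal.toENat (Module.rank (BaseField ψ) M)

end Localized

/-! ### Winding numbers -/

section Winding

/-- The punctured complex plane. -/
abbrev CStar : Type := {z : ℂ // z ≠ 0}

/-- The principal logarithm of `z`, as a point over `z` of the covering `exp : ℂ → ℂ ∖ {0}`. -/
def logPoint (z : CStar) : (fun w : ℂ => (⟨_, w.exp_ne_zero⟩ : CStar)) ⁻¹' {z} :=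
  ⟨Complex.log z.1, Subtype.ext (Complex.exp_log z.2)⟩

theorem exists_winding (z : CStar) (γ : FundamentalGroup CStar z) :
    ∃ n : ℤ, (Complex.isCoveringMap_exp.monodromy γ (logPoint z) : ℂ) =
      Complex.log z.1 + n * (2 * Real.pi * Complex.I) := by
  have h := (Complex.isCoveringMap_exp.monodromy γ (logPoint z)).2
  have h' : Complex.exp (Complex.isCoveringMap_exp.monodromy γ (logPoint z) : ℂ) =
      Complex.exp (Complex.log z.1) := by
    rw [Complex.exp_log z.2]
    exact congrArg Subtype.val h
  exact Complex.exp_eq_exp_iff_exists_int.1 h'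

/-- The winding number around `0` of a loop in `ℂ ∖ {0}`: a continuous logarithm along the loop
changes by `2πi` times the winding number. -/
def winding (z : CStar) (γ : FundamentalGroup CStar z) : ℤ := (exists_winding z γ).choose

theorem winding_spec (z : CStar) (γ : FundamentalGroup CStar z) :
    (Complex.isCoveringMap_exp.monodromy γ (logPoint z) : ℂ) =
      Complex.log z.1 + winding z γ * (2 * Real.pi * Complex.I) :=
  (exists_winding z γ).choose_spec

/-- The winding number computed from an arbitrary continuous logarithm of the loop. -/
theorem winding_eq_of_lift (z : CStar) (p : Path z z) (θ : C(unitInterval, ℂ))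
    (hθ : ∀ t, Complex.exp (θ t) = (p t : ℂ)) (n : ℤ)
    (hn : θ 1 - θ 0 = n * (2 * Real.pi * Complex.I)) :
    winding z (FundamentalGroup.fromPath (Path.Homotopic.Quotient.mk p)) = n := by
  have hc : Complex.exp (θ 0 - Complex.log z.1) = 1 := by
    rw [Complex.exp_sub, Complex.exp_log z.2, hθ 0, p.source, div_self z.2]
  let Θ : C(unitInterval, ℂ) := ⟨fun t => θ t - (θ 0 - Complex.log z.1), by fun_prop⟩
  have h1 : (Complex.isCoveringMap_exp.monodromy
      (FundamentalGroup.fromPath (Path.Homotopic.Quotient.mk p)) (logPoint z) : ℂ) = Θ 1 := by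
    have h2 : Θ = Complex.isCoveringMap_exp.liftPath p.toContinuousMap (logPoint z).1
        (p.source.trans (logPoint z).2.symm) := by
      rw [Complex.isCoveringMap_exp.eq_liftPath_iff']
      refine ⟨?_, ?_⟩
      · funext t
        apply Subtype.ext
        change Complex.exp (θ t - (θ 0 - Complex.log z.1)) = (p t : ℂ)
        rw [Complex.exp_sub, hc, div_one, hθ t]
      · change θ 0 - (θ 0 - Complex.log z.1) = Complex.log z.1
        ring
    rw [h2]
    rfl
  have h3 := winding_spec z (FundamentalGroup.fromPath (Path.Homotopic.Quotient.mk p))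
  rw [h1] at h3
  have h4 : Θ 1 = Complex.log z.1 + n * (2 * Real.pi * Complex.I) := by
    change θ 1 - (θ 0 - Complex.log z.1) = _
    rw [← hn]
    ring
  rw [h4] at h3
  have h5 := mul_right_cancel₀ Complex.two_pi_I_ne_zero (add_left_cancel h3)
  exact (Int.cast_injective h5).symm

theorem monodromy_eq_add_winding (z : CStar) (γ : FundamentalGroup CStar z)
    (e : (fun w : ℂ => (⟨_, w.exp_ne_zero⟩ : CStar)) ⁻¹' {z}) :
    (Complex.isCoveringMap_exp.monodromy γ e : ℂ) =
      e.1 + winding z γ * (2 * Real.pi * Complex.I) := by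
  obtain ⟨p, rfl⟩ := Path.Homotopic.Quotient.mk_surjective γ
  have he : Complex.exp e.1 = z.1 := congrArg Subtype.val e.2
  have h0 : p.toContinuousMap 0 = (⟨_, (e.1).exp_ne_zero⟩ : CStar) := p.source.trans e.2.symm
  have hl := Complex.isCoveringMap_exp.liftPath_lifts p.toContinuousMap e.1 h0
  have hz := Complex.isCoveringMap_exp.liftPath_zero p.toContinuousMap e.1 h0
  have hm : Complex.exp (Complex.isCoveringMap_exp.liftPath p.toContinuousMap e.1 h0 1) =
      Complex.exp e.1 := by
    rw [he, ← congrArg Subtype.val p.target]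
    exact congrArg Subtype.val (congrFun hl 1)
  obtain ⟨n, hn⟩ := Complex.exp_eq_exp_iff_exists_int.1 hm
  have hw := winding_eq_of_lift z p (Complex.isCoveringMap_exp.liftPath p.toContinuousMap e.1 h0)
    (fun t => congrArg Subtype.val (congrFun hl t)) n (by rw [hz, hn]; ring)
  change Complex.isCoveringMap_exp.liftPath p.toContinuousMap e.1 h0 1 = _
  rw [hn]
  congr 3
  exact hw.symm

/-- The winding number as a homomorphism. -/
def windingHom (z : CStar) : FundamentalGroup CStar z →* Multiplicative ℤ where
  toFun γ := Multiplicative.ofAdd (winding z γ)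
  map_one' := by
    have h := winding_eq_of_lift z (Path.refl z) (ContinuousMap.const _ (Complex.log z.1))
      (fun _ => Complex.exp_log z.2) 0 (by simp)
    exact congrArg Multiplicative.ofAdd h
  map_mul' γ γ' := by
    have h1 := monodromy_eq_add_winding z (γ * γ') (logPoint z)
    rw [FundamentalGroup.mul_def, Complex.isCoveringMap_exp.monodromy_trans_apply,
      monodromy_eq_add_winding z γ, monodromy_eq_add_winding z γ', ← FundamentalGroup.mul_def,
      add_assoc, ← add_mul] at h1
    have h2 := mul_right_cancel₀ Complex.two_pi_I_ne_zero (add_left_cancel h1)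
    have h3 : winding z γ' + winding z γ = winding z (γ * γ') := by exact_mod_cast h2
    rw [← h3, add_comm]
    rfl

end Winding

/-! ### Affine plane curves -/

/-- A reduced affine plane curve in `ℂ²` with `m` irreducible components, given by the equations
`f 0 = 0, …, f (m - 1) = 0` of the components: irreducible polynomials in two variables, no two of
which are proportional. -/
structure AffinePlaneCurve (m : ℕ) where
  f : Fin m → MvPolynomial (Fin 2) ℂ
  irreducible : ∀ i, Irreducible (f i)
  not_associated : ∀ i j, i ≠ j → ¬ Associated (f i) (f j)

namespace AffinePlaneCurve

variable {m : ℕ} (C : AffinePlaneCurve m)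

/-- The curve as a subset of `ℂ²`. -/
def carrier : Set (Fin 2 → ℂ) := {p | ∃ i, MvPolynomial.eval p (C.f i) = 0}

/-- The complement `U = ℂ² ∖ C`. -/
abbrev Complement : Type := {p : Fin 2 → ℂ // p ∉ C.carrier}

/-- The `i`-th defining polynomial as a map `U → ℂ ∖ {0}`. -/
def evalMap (i : Fin m) : C(C.Complement, CStar) where
  toFun p := ⟨MvPolynomial.eval p.1 (C.f i), fun h => p.2 ⟨i, h⟩⟩
  continuous_toFun := ((MvPolynomial.continuous_eval (C.f i)).comp continuous_subtype_val).subtype_mk _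

variable (u₀ : C.Complement)

/-- `G = π₁(U, u₀)`. -/
abbrev G : Type := FundamentalGroup C.Complement u₀

/-- `Γ₀ = H`, the maximal torsion-free abelian quotient of `G`. -/
abbrev H : Type := FreeAb (C.G u₀)

/-- The linking number with the `i`-th component, `α ↦ lk(α, Cᵢ)`: the winding number of `fᵢ ∘ α`
around `0`. It is `1` on positive meridians of `Cᵢ` and `0` on meridians of the others. -/
def lk (i : Fin m) : C.G u₀ →* Multiplicative ℤ :=
  (windingHom (C.evalMap i u₀)).comp (FundamentalGroup.map (C.evalMap i) u₀)

/-- The homomorphism `H → ℤ^m` given by the linking numbers with the components. It is the inverse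
of the identification of `ℤ^m` with `H` through meridians: the element of `H` corresponding to
the monomial `t₁^{i₁} ⋯ t_m^{i_m}` has `exponent` `(i₁, …, i_m)`. -/
def exponent (h : C.H u₀) (i : Fin m) : ℤ := Multiplicative.toAdd (liftFreeAb (C.lk u₀ i) h)

/-- The homomorphism `ψ̄ : Γ₀ → ℤ` induced by the total linking number
`ψ(α) = lk(α, C) = ∑ lk(α, Cᵢ)`. -/
def psi : C.H u₀ →* Multiplicative ℤ := ∏ i, liftFreeAb (C.lk u₀ i)

/-- The tautological character of `G` with values in `ℤ[H]`. -/
def rhoH : C.G u₀ →* (MonoidAlgebra ℤ (C.H u₀))ˣ :=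
  ((MonoidAlgebra.of ℤ (C.H u₀)).comp (toFreeAb (C.G u₀))).toHomUnits

/-- The ring `R₀ = ℤ[Γ₀] S₀⁻¹`, where `S₀ = ℤ[ker ψ̄] ∖ {0}`. -/
abbrev R₀ : Type := LocalizedRing (C.psi u₀)

/-- The character of `G` with values in `R₀`. -/
def rhoR₀ : C.G u₀ →* (C.R₀ u₀)ˣ :=
  (Units.map (algebraMap (MonoidAlgebra ℤ (C.H u₀)) (C.R₀ u₀)).toMonoidHom).comp (C.rhoH u₀)

/-- The `0`-th order degree `δ₀(C)`: the dimension over `𝕂₀` of `H₁(U; R₀)`, in `ℕ ∪ {∞}`. -/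
def delta₀ : ℕ∞ := rankOverBase (C.psi u₀) (H1 (C.rhoR₀ u₀))

/-- The Alexander module `A_G = H₁(U, u₀; ℤ[H])`. -/
abbrev AlexanderModule : Type := relH1 (C.rhoH u₀) {u₀}

/-- `Δ ∈ ℤ[H]` is an Alexander polynomial of `C`: a greatest common divisor of the first elementary
ideal of the Alexander module. It is determined up to a unit. -/
def IsAlexanderPolynomial (Δ : MonoidAlgebra ℤ (C.H u₀)) : Prop :=
  ∃ I : Ideal (MonoidAlgebra ℤ (C.H u₀)),
    IsElementaryIdeal 1 (C.AlexanderModule u₀) I ∧ IsGcdOf I Δ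

open Classical in
/-- The (total) degree of a Laurent polynomial: the largest minus the smallest total exponent
`i₁ + ⋯ + i_m` of the monomials that occur in it (and `0` for the zero polynomial). -/
def degree (q : MonoidAlgebra ℤ (C.H u₀)) : ℕ :=
  if hq : q.coeff.support.Nonempty then
    (q.coeff.support.sup' hq (fun h => ∑ i, C.exponent u₀ h i) -
      q.coeff.support.inf' hq (fun h => ∑ i, C.exponent u₀ h i)).toNat
  else 0

end AffinePlaneCurve

end PlaneCurve

/-!
The proof compares both sides with the order ideal of `N = H₁(U; R₀)` over `R₀ = ℤ[H] S₀⁻¹`.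

*The exact sequence of the pair.* The complement `U` is path connected, and the sequence of
`(U, u₀)` reads `0 → N → A₀ → R₀` with `A₀ = H₁(U, u₀; R₀)` (`toRelH1_injective`, `range_toRelH1`);
the image of the connecting homomorphism is the ideal generated by all `ρ(g) - 1`. As there are at
least two components, a quotient of two meridians gives some `h ≠ 1` in `ker ψ`, and `h - 1` lies in
`S₀`, so the connecting homomorphism is onto (`connecting_rhoR₀_surjective`). Meridians come from a
small circle around a smooth point of a component in a transversal complex line
(`exists_meridian`); such a point exists by the Nullstellensatz.

*The ring `R₀`.* The same exact sequence over `ℤ[H]` shows that the augmentation ideal of `ℤ[H]` is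
finitely generated when the Alexander module is. Hence `H` is a finitely generated free abelian
group (`group_fg_H`), and `ℤ[H]` is factorial, being a localization of a polynomial ring. A class
`t` with `ψ(t) = 1` makes `R₀` the ring of Laurent polynomials in `t` over `𝕂₀`
(`isLaurent_localizedRing`), which is a principal ideal domain.

*Elementary ideals.* A presentation matrix `Φ` of the Alexander module over `ℤ[H]` becomes one of
`A₀` over `R₀` (`IsPresentation.of_isLocalization`). If `N` is finite dimensional it is torsion;
with `N ≅ ⨁ R₀ / (aᵢ)` the first elementary ideal of `A₀` is generated by `∏ aᵢ`
(`exists_minorIdeal_one_eq`). This ideal is also generated by the image of the greatest common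
divisor `Δ`, because greatest common divisors in a factorial ring pass to localizations
(`IsGcdOf.map_eq_span`). So `∏ aᵢ` and `Δ` agree up to a unit of `R₀`.

*Degrees.* Multiplied by a monomial, `Δ` is a polynomial in `t` over `ℤ[ker ψ]` with non-zero
constant term, of degree `deg Δ` (`exists_ofKerPoly_natDegree`), and for such a polynomial `p` the
dimension of `K[t, t⁻¹] / (p)` over `K` is the degree of `p` (`IsLaurent.rank_eq_natDegree`).
-/

namespace PlaneCurve

/-! ### Fibres of a rank one local system -/

section Fibres

variable {X : Type*} [TopologicalSpace X] {x₀ : X} {R : Type*} [CommRing R]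
  (ρ : FundamentalGroup X x₀ →* Rˣ)

theorem refl_trans {x y : X} (p : Path.Homotopic.Quotient x y) :
    (Path.Homotopic.Quotient.refl x).trans p = p := by
  have h (a b : FundamentalGroupoid X) (f : a ⟶ b) := CategoryTheory.Category.id_comp f
  exact h ⟨x⟩ ⟨y⟩ p

theorem trans_refl {x y : X} (p : Path.Homotopic.Quotient x y) :
    p.trans (Path.Homotopic.Quotient.refl y) = p := by
  have h (a b : FundamentalGroupoid X) (f : a ⟶ b) := CategoryTheory.Category.comp_id f
  exact h ⟨x⟩ ⟨y⟩ p

theorem trans_symm {x y : X} (p : Path.Homotopic.Quotient x y) :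
    p.trans p.symm = Path.Homotopic.Quotient.refl x := by
  have h (a b : FundamentalGroupoid X) (f : a ⟶ b) := CategoryTheory.Groupoid.comp_inv f
  exact h ⟨x⟩ ⟨y⟩ p

theorem symm_trans {x y : X} (p : Path.Homotopic.Quotient x y) :
    p.symm.trans p = Path.Homotopic.Quotient.refl y := by
  have h (a b : FundamentalGroupoid X) (f : a ⟶ b) := CategoryTheory.Groupoid.inv_comp f
  exact h ⟨x⟩ ⟨y⟩ p

theorem trans_symm_cancel {x y z : X} (p : Path.Homotopic.Quotient x y)
    (q : Path.Homotopic.Quotient z y) : (p.trans q.symm).trans q = p := by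
  rw [trans_assoc, symm_trans, trans_refl]

theorem trans_trans_symm_cancel {x y z : X} (p : Path.Homotopic.Quotient x y)
    (q : Path.Homotopic.Quotient y z) : (p.trans q).trans q.symm = p := by
  rw [trans_assoc, trans_symm, trans_refl]

theorem Fibre.equivariant {x : X} (s : Fibre ρ x) (g : Path.Homotopic.Quotient x₀ x₀)
    (p : Path.Homotopic.Quotient x₀ x) :
    s.1 (g.trans p) = (ρ (FundamentalGroup.fromPath g) : R) * s.1 p := s.2 g p

/-- Evaluation at a homotopy class of paths identifies the fibre with the ring. -/
def fibreEquiv {x : X} (p : Path.Homotopic.Quotient x₀ x) : Fibre ρ x ≃ₗ[R] R where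
  toFun s := s.1 p
  map_add' _ _ := rfl
  map_smul' _ _ := rfl
  invFun r := ⟨fun q => (ρ (FundamentalGroup.fromPath (q.trans p.symm)) : R) * r, by
    intro g q
    have h : (FundamentalGroup.fromPath
        (((FundamentalGroup.toPath g).trans q).trans p.symm) : FundamentalGroup X x₀) =
        FundamentalGroup.fromPath (q.trans p.symm) * g := by
      rw [FundamentalGroup.mul_def, trans_assoc]
    beta_reduce
    rw [h, map_mul, Units.val_mul, mul_assoc, mul_left_comm]⟩
  left_inv s := by
    apply Subtype.ext
    funext q
    change (ρ (FundamentalGroup.fromPath (q.trans p.symm)) : R) * s.1 p = s.1 q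
    rw [← Fibre.equivariant, trans_symm_cancel]
  right_inv r := by
    change (ρ (FundamentalGroup.fromPath (p.trans p.symm)) : R) * r = r
    rw [trans_symm]
    have h : ρ (FundamentalGroup.fromPath (Path.Homotopic.Quotient.refl x₀)) = 1 := map_one ρ
    rw [h, Units.val_one, one_mul]

theorem fibreEquiv_apply {x : X} (p : Path.Homotopic.Quotient x₀ x) (s : Fibre ρ x) :
    fibreEquiv ρ p s = s.1 p := rfl

theorem fibreEquiv_symm_apply {x : X} (p q : Path.Homotopic.Quotient x₀ x) (r : R) :
    ((fibreEquiv ρ p).symm r).1 q = (ρ (FundamentalGroup.fromPath (q.trans p.symm)) : R) * r := rfl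

theorem transport_fibreEquiv_symm {x y : X} (p : Path.Homotopic.Quotient x₀ x)
    (q : Path.Homotopic.Quotient x y) (r : R) :
    transport ρ q ((fibreEquiv ρ p).symm r) = (fibreEquiv ρ (p.trans q)).symm r := by
  apply (fibreEquiv ρ (p.trans q)).injective
  rw [LinearEquiv.apply_symm_apply]
  change ((fibreEquiv ρ p).symm r).1 ((p.trans q).trans q.symm) = r
  rw [trans_trans_symm_cancel, ← fibreEquiv_apply, LinearEquiv.apply_symm_apply]

theorem transport_refl {x : X} (s : Fibre ρ x) :
    transport ρ (Path.Homotopic.Quotient.refl x) s = s := by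
  apply Subtype.ext
  funext p
  change s.1 (p.trans (Path.Homotopic.Quotient.refl x)) = s.1 p
  rw [trans_refl]

/-- The fibre over a point in another path component than the base point is zero. -/
theorem subsingleton_fibre {x : X} (h : IsEmpty (Path.Homotopic.Quotient x₀ x)) :
    Subsingleton (Fibre ρ x) :=
  ⟨fun _ _ => Subtype.ext (funext fun p => h.elim p)⟩

end Fibres

/-! ### Singular chains with local coefficients in low degrees -/

section Chains

variable {X : Type*} [TopologicalSpace X] {x₀ : X} {R : Type*} [CommRing R]
  (ρ : FundamentalGroup X x₀ →* Rˣ)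

open Classical in
/-- The elementary chain `s · σ`. -/
def single {n : ℕ} (σ : C(Simplex n, X)) : Fibre ρ (σ (baseVertex n)) →ₗ[R] Chain ρ n :=
  DirectSum.lof R C(Simplex n, X) (fun τ => Fibre ρ (τ (baseVertex n))) σ

theorem single_apply_self {n : ℕ} (σ : C(Simplex n, X)) (a : Fibre ρ (σ (baseVertex n))) :
    single ρ σ a σ = a := by
  classical
  exact DirectSum.of_eq_same (β := fun τ : C(Simplex n, X) => Fibre ρ (τ (baseVertex n))) σ a

theorem single_apply_ne {n : ℕ} {σ τ : C(Simplex n, X)} (h : σ ≠ τ)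
    (a : Fibre ρ (σ (baseVertex n))) : single ρ σ a τ = 0 := by
  classical
  exact DirectSum.of_eq_of_ne _ _ _ h.symm

theorem chain_induction {n : ℕ} {P : Chain ρ n → Prop} (c : Chain ρ n) (h0 : P 0)
    (h1 : ∀ σ a, P (single ρ σ a)) (h2 : ∀ c d, P c → P d → P (c + d)) : P c := by
  classical
  exact DirectSum.induction_on c h0 h1 h2

theorem boundary_single {n : ℕ} (σ : C(Simplex (n + 1), X))
    (a : Fibre ρ (σ (baseVertex (n + 1)))) :
    boundary ρ n (single ρ σ a) = ∑ i : Fin (n + 2), ((-1 : R) ^ (i : ℕ)) •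
      single ρ (σ.comp (face n i)) (transport ρ (Path.Homotopic.Quotient.mk
          ((segmentPath (baseVertex (n + 1)) (face n i (baseVertex n))).map σ.continuous)) a) := by
  classical
  unfold boundary single
  rw [DirectSum.toModule_lof, LinearMap.sum_apply]
  rfl

/-- A chain supported in `A` is a sum of elementary chains supported in `A`. -/
theorem chainsIn_induction {A : Set X} {n : ℕ} (P : Submodule R (Chain ρ n))
    (h : ∀ (σ : C(Simplex n, X)) a, Set.range σ ⊆ A → single ρ σ a ∈ P) :
    chainsIn ρ A n ≤ P := by
  classical
  intro c hc
  rw [← DirectSum.sum_support_of c]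
  refine Submodule.sum_mem _ fun σ hσ => h σ _ (hc σ ?_)
  exact DFinsupp.mem_support_iff.1 hσ

theorem single_mem_chainsIn {A : Set X} {n : ℕ} {σ : C(Simplex n, X)} (h : Set.range σ ⊆ A)
    (a : Fibre ρ (σ (baseVertex n))) : single ρ σ a ∈ chainsIn ρ A n := by
  intro τ hτ
  by_cases h1 : σ = τ
  · exact h1 ▸ h
  · exact absurd (single_apply_ne ρ h1 a) hτ

theorem chainsIn_empty (n : ℕ) : chainsIn ρ (∅ : Set X) n = ⊥ := by
  rw [eq_bot_iff]
  refine chainsIn_induction ρ _ fun σ a h => ?_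
  exact absurd (h ⟨baseVertex n, rfl⟩) (Set.notMem_empty _)

theorem eq_const_of_range_subset {n : ℕ} {σ : C(Simplex n, X)} {x : X}
    (h : Set.range σ ⊆ {x}) : σ = ContinuousMap.const _ x :=
  ContinuousMap.ext fun t => h ⟨t, rfl⟩

theorem range_const_subset (n : ℕ) (x : X) :
    Set.range (ContinuousMap.const (Simplex n) x) ⊆ {x} := by
  rintro _ ⟨t, rfl⟩
  rfl

theorem transport_const {n : ℕ} {x : X} (a b : Simplex n) (s : Fibre ρ x) :
    transport ρ (Path.Homotopic.Quotient.mk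
      ((segmentPath a b).map (ContinuousMap.const (Simplex n) x).continuous)) s = s := by
  have h : (Path.Homotopic.Quotient.mk
      ((segmentPath a b).map (ContinuousMap.const (Simplex n) x).continuous) :
      Path.Homotopic.Quotient x x) = Path.Homotopic.Quotient.refl x := by
    rw [← Path.Homotopic.Quotient.mk_refl]
    rfl
  exact (congrArg (fun q => transport ρ q s) h).trans (transport_refl ρ s)

theorem boundary_single_const_one (x : X) (a : Fibre ρ x) :
    boundary ρ 0 (single ρ (ContinuousMap.const _ x) a) = 0 := by
  refine (boundary_single ρ (ContinuousMap.const (Simplex 1) x) a).trans ?_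
  rw [Fin.sum_univ_two]
  have h (i : Fin 2) : single ρ ((ContinuousMap.const (Simplex 1) x).comp (face 0 i))
      (transport ρ (Path.Homotopic.Quotient.mk
          ((segmentPath (baseVertex 1) (face 0 i (baseVertex 0))).map
            (ContinuousMap.const (Simplex 1) x).continuous)) a) =
      single ρ (ContinuousMap.const (Simplex 0) x) a :=
    congrArg (single ρ (ContinuousMap.const (Simplex 0) x)) (transport_const ρ _ _ a)
  rw [h, h]
  simp

theorem boundary_single_const_two (x : X) (a : Fibre ρ x) :
    boundary ρ 1 (single ρ (ContinuousMap.const _ x) a) =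
      single ρ (ContinuousMap.const _ x) a := by
  refine (boundary_single ρ (ContinuousMap.const (Simplex 2) x) a).trans ?_
  rw [Fin.sum_univ_three]
  have h (i : Fin 3) : single ρ ((ContinuousMap.const (Simplex 2) x).comp (face 1 i))
      (transport ρ (Path.Homotopic.Quotient.mk
          ((segmentPath (baseVertex 2) (face 1 i (baseVertex 1))).map
            (ContinuousMap.const (Simplex 2) x).continuous)) a) =
      single ρ (ContinuousMap.const (Simplex 1) x) a :=
    congrArg (single ρ (ContinuousMap.const (Simplex 1) x)) (transport_const ρ _ _ a)
  rw [h, h, h]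
  simp

theorem chainsIn_point_le_range_boundary (x : X) :
    chainsIn ρ {x} 1 ≤ LinearMap.range (boundary ρ 1) := by
  refine chainsIn_induction ρ _ fun σ a h => ?_
  obtain rfl := eq_const_of_range_subset h
  exact ⟨_, boundary_single_const_two ρ x a⟩

theorem simplex_zero_eq_const {Y : Type*} [TopologicalSpace Y] (g : C(Simplex 0, Y)) :
    g = ContinuousMap.const _ (g (baseVertex 0)) := by
  refine ContinuousMap.ext fun t => ?_
  rw [Subsingleton.elim t (baseVertex 0)]
  rfl

instance (n : ℕ) : ContractibleSpace (Simplex n) :=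
  (convex_stdSimplex ℝ (Fin (n + 1))).contractibleSpace ⟨_, (baseVertex n).2⟩

/-- An elementary `0`-chain at a point of a singular simplex `σ`, whose coefficient is transported
along `σ`, depends only on the point: paths in the standard simplex with equal end points are
homotopic. -/
theorem single_comp_eq {n : ℕ} (σ : C(Simplex n, X)) {v₀ : Simplex n}
    (p : Path.Homotopic.Quotient x₀ (σ v₀)) (r : R) (g g' : C(Simplex 0, Simplex n))
    (h : g (baseVertex 0) = g' (baseVertex 0))
    (w : Path.Homotopic.Quotient v₀ (g (baseVertex 0)))
    (w' : Path.Homotopic.Quotient v₀ (g' (baseVertex 0))) :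
    single ρ (σ.comp g) ((fibreEquiv ρ (p.trans (w.map σ))).symm r) =
      single ρ (σ.comp g') ((fibreEquiv ρ (p.trans (w'.map σ))).symm r) := by
  have hg : g = g' := by
    rw [simplex_zero_eq_const g, simplex_zero_eq_const g', h]
  subst hg
  rw [Subsingleton.elim w w']

theorem face_face_baseVertex (i : Fin 3) (j : Fin 2) :
    face 1 i (face 0 j (baseVertex 0)) = stdSimplex.vertex (i.succAbove (j.succAbove 0)) := by
  change stdSimplex.map _ (stdSimplex.map _ (stdSimplex.vertex _)) = _
  rw [stdSimplex.map_vertex, stdSimplex.map_vertex]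

theorem boundary_boundary [PathConnectedSpace X] (c : Chain ρ 2) :
    boundary ρ 0 (boundary ρ 1 c) = 0 := by
  induction c using chain_induction with
  | h0 => simp
  | h2 c d hc hd => rw [map_add, map_add, hc, hd, add_zero]
  | h1 σ a =>
    let p : Path.Homotopic.Quotient x₀ (σ (baseVertex 2)) :=
      Path.Homotopic.Quotient.mk (PathConnectedSpace.somePath _ _)
    obtain ⟨r, rfl⟩ := (fibreEquiv ρ p).symm.surjective a
    let w (i : Fin 3) : Path.Homotopic.Quotient (baseVertex 2) (face 1 i (baseVertex 1)) :=
      Path.Homotopic.Quotient.mk (segmentPath _ _)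
    let w' (i : Fin 3) (j : Fin 2) : Path.Homotopic.Quotient (face 1 i (baseVertex 1))
        (face 1 i (face 0 j (baseVertex 0))) :=
      (Path.Homotopic.Quotient.mk (segmentPath _ _)).map (face 1 i)
    -- The two faces of the `i`-th face, with transported coefficients.
    let e (i : Fin 3) (j : Fin 2) : Chain ρ 0 := single ρ (σ.comp ((face 1 i).comp (face 0 j)))
      ((fibreEquiv ρ (p.trans (((w i).trans (w' i j)).map σ))).symm r)
    have h1 (i : Fin 3) : boundary ρ 0 (single ρ (σ.comp (face 1 i))
        (transport ρ (Path.Homotopic.Quotient.mk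
          ((segmentPath (baseVertex 2) (face 1 i (baseVertex 1))).map σ.continuous))
          ((fibreEquiv ρ p).symm r))) = e i 0 - e i 1 := by
      have h2 (j : Fin 2) : single ρ ((σ.comp (face 1 i)).comp (face 0 j))
          (transport ρ (Path.Homotopic.Quotient.mk
            ((segmentPath (baseVertex 1) (face 0 j (baseVertex 0))).map
              (σ.comp (face 1 i)).continuous))
          (transport ρ (Path.Homotopic.Quotient.mk
            ((segmentPath (baseVertex 2) (face 1 i (baseVertex 1))).map σ.continuous))
            ((fibreEquiv ρ p).symm r))) = e i j := by
        rw [transport_fibreEquiv_symm, transport_fibreEquiv_symm, trans_assoc]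
        have h3 : ((w i).trans (w' i j)).map σ = (Path.Homotopic.Quotient.mk
            ((segmentPath (baseVertex 2) (face 1 i (baseVertex 1))).map σ.continuous)).trans
            (Path.Homotopic.Quotient.mk
            ((segmentPath (baseVertex 1) (face 0 j (baseVertex 0))).map
              (σ.comp (face 1 i)).continuous)) := by
          change Path.Homotopic.Quotient.mk (Path.map (Path.trans _ _) _) = _
          rw [Path.map_trans]
          rfl
        change _ = single ρ _ _
        rw [h3]
        rfl
      rw [boundary_single, Fin.sum_univ_two, h2, h2]
      simp [sub_eq_add_neg]
    have h4 (i i' : Fin 3) (j j' : Fin 2)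
        (h : i.succAbove (j.succAbove 0) = i'.succAbove (j'.succAbove 0)) : e i j = e i' j' := by
      refine single_comp_eq ρ σ p r _ _ ?_ _ _
      change face 1 i (face 0 j (baseVertex 0)) = face 1 i' (face 0 j' (baseVertex 0))
      rw [face_face_baseVertex, face_face_baseVertex, h]
    rw [boundary_single, Fin.sum_univ_three]
    simp only [map_add, map_smul, h1]
    rw [h4 0 1 0 0 (by decide), h4 0 2 1 0 (by decide), h4 1 2 1 1 (by decide)]
    simp

end Chains

/-! ### The exact sequence of the pair of a space and its base point -/

section Pair

variable {X : Type*} [TopologicalSpace X] {x₀ : X} {R : Type*} [CommRing R]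
  (ρ : FundamentalGroup X x₀ →* Rˣ)

/-- The elementary `0`-chain `s · x` at a point `x`. -/
def pointChain (x : X) : Fibre ρ x →ₗ[R] Chain ρ 0 :=
  single ρ (ContinuousMap.const (Simplex 0) x)

/-- The coefficient of a `0`-chain at the base point, as an element of the ring. -/
def baseCoeff : Chain ρ 0 →ₗ[R] R :=
  (fibreEquiv ρ (Path.Homotopic.Quotient.refl x₀)).toLinearMap ∘ₗ
    DirectSum.component R C(Simplex 0, X) (fun τ => Fibre ρ (τ (baseVertex 0)))
      (ContinuousMap.const _ x₀)

theorem baseCoeff_pointChain (a : Fibre ρ x₀) :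
    baseCoeff ρ (pointChain ρ x₀ a) = fibreEquiv ρ (Path.Homotopic.Quotient.refl x₀) a :=
  congrArg (fibreEquiv ρ (Path.Homotopic.Quotient.refl x₀))
    (single_apply_self ρ (ContinuousMap.const (Simplex 0) x₀) a)

theorem eq_pointChain_of_mem_chainsIn {c : Chain ρ 0} (hc : c ∈ chainsIn ρ {x₀} 0) :
    c = pointChain ρ x₀ ((fibreEquiv ρ (Path.Homotopic.Quotient.refl x₀)).symm
      (baseCoeff ρ c)) := by
  let P : Submodule R (Chain ρ 0) := LinearMap.eqLocus LinearMap.id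
    (pointChain ρ x₀ ∘ₗ (fibreEquiv ρ (Path.Homotopic.Quotient.refl x₀)).symm.toLinearMap ∘ₗ
      baseCoeff ρ)
  refine chainsIn_induction ρ P (fun σ a h => ?_) hc
  obtain rfl := eq_const_of_range_subset h
  have h1 (a : Fibre ρ x₀) : pointChain ρ x₀ a = pointChain ρ x₀ ((fibreEquiv ρ
      (Path.Homotopic.Quotient.refl x₀)).symm (baseCoeff ρ (pointChain ρ x₀ a))) := by
    rw [baseCoeff_pointChain, LinearEquiv.symm_apply_apply]
  exact h1 a

theorem relBoundaries_le_ker [PathConnectedSpace X] :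
    relBoundaries ρ {x₀} ≤ LinearMap.ker (baseCoeff ρ ∘ₗ boundary ρ 0) := by
  refine sup_le ?_ (chainsIn_induction ρ _ fun σ a h => ?_)
  · rintro _ ⟨d, rfl⟩
    change baseCoeff ρ (boundary ρ 0 (boundary ρ 1 d)) = 0
    rw [boundary_boundary, map_zero]
  · obtain rfl := eq_const_of_range_subset h
    have h1 : baseCoeff ρ (boundary ρ 0 (single ρ (ContinuousMap.const (Simplex 1) x₀) a)) = 0 :=
      (congrArg (baseCoeff ρ) (boundary_single_const_one ρ x₀ a)).trans (map_zero _)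
    exact h1

/-- The connecting homomorphism `H₁(X, x₀; L_ρ) → H₀(x₀; L_ρ) = R`. -/
def connecting [PathConnectedSpace X] : relH1 ρ {x₀} →ₗ[R] R :=
  Submodule.liftQ _ ((baseCoeff ρ ∘ₗ boundary ρ 0) ∘ₗ (relCycles ρ {x₀}).subtype)
    (fun _ hc => relBoundaries_le_ker ρ hc)

theorem connecting_mk [PathConnectedSpace X] (c : relCycles ρ {x₀}) :
    connecting ρ (Submodule.Quotient.mk c) = baseCoeff ρ (boundary ρ 0 c.1) := rfl

theorem mem_relCycles_empty {c : Chain ρ 1} :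
    c ∈ relCycles ρ (∅ : Set X) ↔ boundary ρ 0 c = 0 := by
  rw [relCycles, chainsIn_empty]
  rfl

theorem relCycles_empty_le (A : Set X) : relCycles ρ (∅ : Set X) ≤ relCycles ρ A := by
  intro c hc
  rw [mem_relCycles_empty] at hc
  change boundary ρ 0 c ∈ chainsIn ρ A 0
  rw [hc]
  exact zero_mem _

theorem relBoundaries_empty : relBoundaries ρ (∅ : Set X) = LinearMap.range (boundary ρ 1) := by
  rw [relBoundaries, chainsIn_empty, sup_bot_eq]

theorem relBoundaries_point (x : X) :
    relBoundaries ρ {x} = LinearMap.range (boundary ρ 1) :=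
  sup_eq_left.2 (chainsIn_point_le_range_boundary ρ x)

/-- The map `H₁(X; L_ρ) → H₁(X, x₀; L_ρ)`. -/
def toRelH1 : H1 ρ →ₗ[R] relH1 ρ {x₀} :=
  Submodule.mapQ _ _ (Submodule.inclusion (relCycles_empty_le ρ {x₀})) (by
    intro c hc
    change c.1 ∈ relBoundaries ρ {x₀}
    have h : c.1 ∈ relBoundaries ρ ∅ := hc
    rwa [relBoundaries_point, ← relBoundaries_empty])

theorem toRelH1_injective : Function.Injective (toRelH1 ρ) := by
  rw [← LinearMap.ker_eq_bot, eq_bot_iff]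
  intro y hy
  obtain ⟨c, rfl⟩ := Submodule.Quotient.mk_surjective _ y
  have h : (Submodule.Quotient.mk (Submodule.inclusion (relCycles_empty_le ρ {x₀}) c) :
      relH1 ρ {x₀}) = 0 := hy
  rw [Submodule.Quotient.mk_eq_zero] at h
  have h1 : c.1 ∈ relBoundaries ρ {x₀} := h
  rw [relBoundaries_point, ← relBoundaries_empty] at h1
  exact (Submodule.Quotient.mk_eq_zero _).2 h1

theorem range_toRelH1 [PathConnectedSpace X] :
    LinearMap.range (toRelH1 ρ) = LinearMap.ker (connecting ρ) := by
  apply le_antisymm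
  · rintro _ ⟨y, rfl⟩
    obtain ⟨c, rfl⟩ := Submodule.Quotient.mk_surjective _ y
    change baseCoeff ρ (boundary ρ 0 c.1) = 0
    rw [(mem_relCycles_empty ρ).1 c.2, map_zero]
  · intro y hy
    obtain ⟨c, rfl⟩ := Submodule.Quotient.mk_surjective _ y
    have h : baseCoeff ρ (boundary ρ 0 c.1) = 0 := hy
    have h1 : boundary ρ 0 c.1 = 0 := by
      rw [eq_pointChain_of_mem_chainsIn ρ c.2, h, map_zero, map_zero]
    exact ⟨Submodule.Quotient.mk ⟨c.1, (mem_relCycles_empty ρ).2 h1⟩, rfl⟩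

/-- The `1`-simplex traced by a loop. -/
def loopSimplex (γ : Path x₀ x₀) : C(Simplex 1, X) where
  toFun v := γ ⟨v.1 1, (v.2.1 1), by
    have h := v.2.2
    rw [Fin.sum_univ_two] at h
    linarith [v.2.1 0]⟩
  continuous_toFun := by
    refine γ.continuous.comp (Continuous.subtype_mk ?_ _)
    exact (continuous_apply 1).comp continuous_subtype_val

theorem loopSimplex_vertex_zero (γ : Path x₀ x₀) :
    loopSimplex γ (stdSimplex.vertex 0) = x₀ := by
  refine Eq.trans (congrArg γ (Subtype.ext ?_)) γ.source
  simp

theorem loopSimplex_vertex_one (γ : Path x₀ x₀) :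
    loopSimplex γ (stdSimplex.vertex 1) = x₀ := by
  refine Eq.trans (congrArg γ (Subtype.ext ?_)) γ.target
  simp

theorem single_eq_pointChain (τ : C(Simplex 0, X)) {x : X} (h : τ (baseVertex 0) = x)
    (p : Path.Homotopic.Quotient x₀ (τ (baseVertex 0))) (r : R) :
    single ρ τ ((fibreEquiv ρ p).symm r) =
      pointChain ρ x ((fibreEquiv ρ (p.cast rfl h.symm)).symm r) := by
  obtain ⟨y, rfl⟩ : ∃ y, τ = ContinuousMap.const _ y := ⟨_, simplex_zero_eq_const τ⟩
  obtain rfl : y = x := h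
  have h1 (q : Path.Homotopic.Quotient x₀ y) : pointChain ρ y ((fibreEquiv ρ q).symm r) =
      pointChain ρ y ((fibreEquiv ρ (q.cast rfl rfl)).symm r) := by
    rw [Path.Homotopic.Quotient.cast_rfl_rfl]
  exact h1 p

theorem face_zero_baseVertex (i : Fin 2) :
    face 0 i (baseVertex 0) = stdSimplex.vertex (i.succAbove 0) :=
  stdSimplex.map_vertex _ _

theorem exists_boundary_loop (γ : Path x₀ x₀) (r : R) : ∃ c : Chain ρ 1,
    boundary ρ 0 c = pointChain ρ x₀ ((fibreEquiv ρ (Path.Homotopic.Quotient.mk γ)).symm r) -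
      pointChain ρ x₀ ((fibreEquiv ρ (Path.Homotopic.Quotient.refl x₀)).symm r) := by
  let p : Path.Homotopic.Quotient x₀ (loopSimplex γ (baseVertex 1)) :=
    (Path.Homotopic.Quotient.refl x₀).cast rfl (loopSimplex_vertex_zero γ)
  have hf (i : Fin 2) : (loopSimplex γ).comp (face 0 i) (baseVertex 0) = x₀ := by
    change loopSimplex γ (face 0 i (baseVertex 0)) = x₀
    rw [face_zero_baseVertex]
    fin_cases i
    · exact loopSimplex_vertex_one γ
    · exact loopSimplex_vertex_zero γ
  have h (i : Fin 2) (δ : Path x₀ x₀)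
      (hδ : ∀ t, loopSimplex γ (segmentPath (baseVertex 1) (face 0 i (baseVertex 0)) t) = δ t) :
      single ρ ((loopSimplex γ).comp (face 0 i)) (transport ρ (Path.Homotopic.Quotient.mk
        ((segmentPath (baseVertex 1) (face 0 i (baseVertex 0))).map (loopSimplex γ).continuous))
        ((fibreEquiv ρ p).symm r)) =
      pointChain ρ x₀ ((fibreEquiv ρ (Path.Homotopic.Quotient.mk δ)).symm r) := by
    rw [transport_fibreEquiv_symm]
    refine (single_eq_pointChain ρ _ (hf i) _ r).trans ?_
    refine congrArg (fun q => pointChain ρ x₀ ((fibreEquiv ρ q).symm r)) ?_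
    rw [← refl_trans (Path.Homotopic.Quotient.mk δ), ← Path.Homotopic.Quotient.mk_refl,
      ← Path.Homotopic.Quotient.mk_trans]
    change Path.Homotopic.Quotient.mk (((((Path.refl x₀).cast rfl
      (loopSimplex_vertex_zero γ)).trans _)).cast rfl (hf i).symm) = _
    congr 1
    ext t
    simp only [Path.cast_coe, Path.trans_apply]
    split_ifs
    · rfl
    · exact hδ _
  refine ⟨single ρ (loopSimplex γ) ((fibreEquiv ρ p).symm r), ?_⟩
  rw [boundary_single, Fin.sum_univ_two, h 0 γ, h 1 (Path.refl x₀), ← sub_eq_zero]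
  · simp [sub_eq_add_neg]
  · intro t
    rw [face_zero_baseVertex]
    change γ _ = x₀
    refine Eq.trans (congrArg γ (Subtype.ext ?_)) γ.source
    simp [segmentPath]
  · intro t
    rw [face_zero_baseVertex]
    refine congrArg γ (Subtype.ext ?_)
    change (AffineMap.lineMap (k := ℝ) (baseVertex 1).1
      (stdSimplex.vertex ((0 : Fin 2).succAbove 0) : Simplex 1).1 (t : ℝ) : Fin 2 → ℝ) 1 = t
    simp [AffineMap.lineMap_apply]

/-- The image of the connecting homomorphism contains all `ρ g - 1`. -/
theorem exists_connecting_eq [PathConnectedSpace X] (g : FundamentalGroup X x₀) :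
    ∃ y, connecting ρ y = (ρ g : R) - 1 := by
  obtain ⟨γ, hγ⟩ := Path.Homotopic.Quotient.mk_surjective (FundamentalGroup.toPath g)
  obtain ⟨c, hc⟩ := exists_boundary_loop ρ γ (ρ g : R)
  have hm : ∀ a : Fibre ρ x₀, pointChain ρ x₀ a ∈ chainsIn ρ ({x₀} : Set X) 0 :=
    single_mem_chainsIn ρ (σ := ContinuousMap.const (Simplex 0) x₀) (range_const_subset 0 x₀)
  have hc' : c ∈ relCycles ρ {x₀} := by
    change boundary ρ 0 c ∈ chainsIn ρ ({x₀} : Set X) 0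
    rw [hc]
    exact sub_mem (hm _) (hm _)
  refine ⟨- Submodule.Quotient.mk ⟨c, hc'⟩, ?_⟩
  rw [map_neg, connecting_mk, hc, map_sub, baseCoeff_pointChain, baseCoeff_pointChain,
    LinearEquiv.apply_symm_apply, fibreEquiv_apply, fibreEquiv_symm_apply, refl_trans, hγ]
  have h : (ρ (FundamentalGroup.fromPath (FundamentalGroup.toPath g).symm) : R) * ρ g = 1 := by
    have h1 : FundamentalGroup.fromPath (FundamentalGroup.toPath g).symm = g⁻¹ := rfl
    rw [h1, map_inv, Units.inv_mul]
  rw [h, neg_sub]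

open Classical in
/-- The linear map on chains with prescribed values on elementary chains. -/
def chainLift {M : Type*} [AddCommGroup M] [Module R M] {n : ℕ}
    (L : ∀ σ : C(Simplex n, X), Fibre ρ (σ (baseVertex n)) →ₗ[R] M) : Chain ρ n →ₗ[R] M :=
  DirectSum.toModule R C(Simplex n, X) M L

theorem chainLift_single {M : Type*} [AddCommGroup M] [Module R M] {n : ℕ}
    (L : ∀ σ : C(Simplex n, X), Fibre ρ (σ (baseVertex n)) →ₗ[R] M) (σ : C(Simplex n, X))
    (a : Fibre ρ (σ (baseVertex n))) : chainLift ρ L (single ρ σ a) = L σ a := by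
  classical
  exact DirectSum.toModule_lof R (φ := L) σ a

/-- A functional on `R` that is invariant under the monodromy extends to an augmentation of
`0`-chains, hence vanishes on the image of the connecting homomorphism. -/
theorem map_connecting_eq_zero [PathConnectedSpace X] {M : Type*} [AddCommGroup M] [Module R M]
    (ε : R →ₗ[R] M) (hε : ∀ g r, ε ((ρ g : R) * r) = ε r) (y : relH1 ρ {x₀}) :
    ε (connecting ρ y) = 0 := by
  have hval {x : X} (s : Fibre ρ x) (p q : Path.Homotopic.Quotient x₀ x) :
      ε (fibreEquiv ρ p s) = ε (fibreEquiv ρ q s) := by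
    rw [fibreEquiv_apply, fibreEquiv_apply, ← trans_symm_cancel p q, Fibre.equivariant, hε]
  let θ : Chain ρ 0 →ₗ[R] M := chainLift ρ fun τ =>
    ε ∘ₗ (fibreEquiv ρ (Path.Homotopic.Quotient.mk
      (PathConnectedSpace.somePath x₀ (τ (baseVertex 0))))).toLinearMap
  have hθ (τ : C(Simplex 0, X)) (a) (p : Path.Homotopic.Quotient x₀ (τ (baseVertex 0))) :
      θ (single ρ τ a) = ε (fibreEquiv ρ p a) :=
    (chainLift_single ρ _ τ a).trans (hval a _ p)
  have hθ0 (c : Chain ρ 1) : θ (boundary ρ 0 c) = 0 := by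
    induction c using chain_induction with
    | h0 => simp
    | h2 c d hc hd => rw [map_add, map_add, hc, hd, add_zero]
    | h1 σ a =>
      let p : Path.Homotopic.Quotient x₀ (σ (baseVertex 1)) :=
        Path.Homotopic.Quotient.mk (PathConnectedSpace.somePath _ _)
      obtain ⟨r, rfl⟩ := (fibreEquiv ρ p).symm.surjective a
      rw [boundary_single, Fin.sum_univ_two]
      have h (i : Fin 2) : θ (single ρ (σ.comp (face 0 i)) (transport ρ
          (Path.Homotopic.Quotient.mk ((segmentPath (baseVertex 1)
            (face 0 i (baseVertex 0))).map σ.continuous)) ((fibreEquiv ρ p).symm r))) = ε r := by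
        rw [transport_fibreEquiv_symm]
        refine (hθ _ _ (p.trans (Path.Homotopic.Quotient.mk ((segmentPath (baseVertex 1)
            (face 0 i (baseVertex 0))).map σ.continuous)))).trans ?_
        rw [LinearEquiv.apply_symm_apply]
      rw [map_add, map_smul, map_smul, h, h]
      simp
  obtain ⟨c, rfl⟩ := Submodule.Quotient.mk_surjective _ y
  rw [connecting_mk, ← hθ0 c.1]
  have h2 := eq_pointChain_of_mem_chainsIn ρ c.2
  generalize boundary ρ 0 c.1 = b at h2
  conv_rhs => rw [h2]
  refine Eq.trans ?_ (hθ (ContinuousMap.const (Simplex 0) x₀) _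
    (Path.Homotopic.Quotient.refl x₀)).symm
  exact congrArg ε (LinearEquiv.apply_symm_apply _ _).symm

/-- The image of the connecting homomorphism is contained in every ideal that contains all
`ρ g - 1`. -/
theorem connecting_mem [PathConnectedSpace X] (I : Ideal R) (hI : ∀ g, (ρ g : R) - 1 ∈ I)
    (y : relH1 ρ {x₀}) : connecting ρ y ∈ I := by
  have h := map_connecting_eq_zero ρ (Submodule.mkQ I) (fun g r => by
    rw [← sub_eq_zero, ← map_sub, ← sub_one_mul]
    exact (Submodule.Quotient.mk_eq_zero I).2 (I.mul_mem_right _ (hI g))) y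
  exact (Submodule.Quotient.mk_eq_zero I).1 h

end Pair

/-! ### Localization of the coefficients -/

section Localization

variable {X : Type*} [TopologicalSpace X] {x₀ : X} {R R' : Type*} [CommRing R] [CommRing R']
  [Algebra R R'] {ρ : FundamentalGroup X x₀ →* Rˣ} {ρ' : FundamentalGroup X x₀ →* R'ˣ}

/-- The map of fibres induced by extension of scalars from `R` to `R'`. -/
def fibreMap (h : ∀ g, (ρ' g : R') = algebraMap R R' (ρ g)) (x : X) :
    Fibre ρ x →+ Fibre ρ' x where
  toFun s := ⟨fun p => algebraMap R R' (s.1 p), by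
    intro g p
    beta_reduce
    rw [s.2 g p, map_mul, h]⟩
  map_zero' := Subtype.ext (funext fun _ => map_zero (algebraMap R R'))
  map_add' _ _ := Subtype.ext (funext fun _ => map_add (algebraMap R R') _ _)

variable (h : ∀ g, (ρ' g : R') = algebraMap R R' (ρ g))

theorem fibreMap_smul {x : X} (r : R) (s : Fibre ρ x) :
    fibreMap h x (r • s) = algebraMap R R' r • fibreMap h x s :=
  Subtype.ext (funext fun _ => map_mul (algebraMap R R') _ _)

theorem fibreEquiv_fibreMap {x : X} (p : Path.Homotopic.Quotient x₀ x) (s : Fibre ρ x) :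
    fibreEquiv ρ' p (fibreMap h x s) = algebraMap R R' (fibreEquiv ρ p s) := rfl

theorem fibreMap_injective (hinj : Function.Injective (algebraMap R R')) (x : X) :
    Function.Injective (fibreMap h x) := by
  intro s t hst
  refine Subtype.ext (funext fun p => hinj ?_)
  exact congrArg (fibreEquiv ρ' p) hst

theorem transport_fibreMap {x y : X} (q : Path.Homotopic.Quotient x y) (s : Fibre ρ x) :
    transport ρ' q (fibreMap h x s) = fibreMap h y (transport ρ q s) := rfl

theorem exists_fibreMap_eq_smul (M : Submonoid R) [IsLocalization M R'] {x : X}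
    (s : Fibre ρ' x) : ∃ m ∈ M, ∃ t, fibreMap h x t = algebraMap R R' m • s := by
  rcases isEmpty_or_nonempty (Path.Homotopic.Quotient x₀ x) with hx | ⟨⟨p⟩⟩
  · have := subsingleton_fibre ρ' hx
    exact ⟨1, M.one_mem, 0, Subsingleton.elim _ _⟩
  · obtain ⟨⟨r, m⟩, hm⟩ := IsLocalization.surj M (fibreEquiv ρ' p s)
    refine ⟨m, m.2, (fibreEquiv ρ p).symm r, (fibreEquiv ρ' p).injective ?_⟩
    rw [fibreEquiv_fibreMap, LinearEquiv.apply_symm_apply, map_smul, smul_eq_mul, ← hm, mul_comm]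

/-- The map of chains induced by extension of scalars from `R` to `R'`. -/
def chainMap (n : ℕ) : Chain ρ n →ₛₗ[algebraMap R R'] Chain ρ' n where
  __ := DirectSum.map fun σ : C(Simplex n, X) => fibreMap h (σ (baseVertex n))
  map_smul' r c := by
    refine DFinsupp.ext fun σ => ?_
    exact fibreMap_smul h r (c σ)

theorem chainMap_apply (n : ℕ) (c : Chain ρ n) (σ : C(Simplex n, X)) :
    chainMap h n c σ = fibreMap h _ (c σ) := rfl

theorem chainMap_single {n : ℕ} (σ : C(Simplex n, X)) (a : Fibre ρ (σ (baseVertex n))) :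
    chainMap h n (single ρ σ a) = single ρ' σ (fibreMap h _ a) := by
  refine DFinsupp.ext fun τ => ?_
  rw [chainMap_apply]
  by_cases hτ : σ = τ
  · subst hτ
    rw [single_apply_self, single_apply_self]
  · rw [single_apply_ne ρ hτ, single_apply_ne ρ' hτ, map_zero]

theorem exists_chainMap_eq_smul (M : Submonoid R) [IsLocalization M R'] (n : ℕ)
    (c : Chain ρ' n) : ∃ m ∈ M, ∃ d, chainMap h n d = algebraMap R R' m • c := by
  induction c using chain_induction with
  | h0 => exact ⟨1, M.one_mem, 0, by simp⟩
  | h1 σ a =>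
    obtain ⟨m, hm, t, ht⟩ := exists_fibreMap_eq_smul h M a
    exact ⟨m, hm, single ρ σ t, by rw [chainMap_single, ht, map_smul]⟩
  | h2 c d hc hd =>
    obtain ⟨m, hm, c', hc'⟩ := hc
    obtain ⟨n, hn, d', hd'⟩ := hd
    refine ⟨m * n, M.mul_mem hm hn, n • c' + m • d', ?_⟩
    rw [map_add, LinearMap.map_smulₛₗ, LinearMap.map_smulₛₗ, hc', hd', smul_add, smul_smul,
      smul_smul, map_mul, mul_comm (algebraMap R R' n)]

theorem boundary_chainMap (n : ℕ) (c : Chain ρ (n + 1)) :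
    boundary ρ' n (chainMap h (n + 1) c) = chainMap h n (boundary ρ n c) := by
  induction c using chain_induction with
  | h0 => simp
  | h2 c d hc hd => rw [map_add, map_add, map_add, map_add, hc, hd]
  | h1 σ a =>
    rw [chainMap_single, boundary_single, boundary_single, map_sum]
    refine Finset.sum_congr rfl fun i _ => ?_
    rw [transport_fibreMap, LinearMap.map_smulₛₗ, chainMap_single]
    simp

theorem chainMap_mem_chainsIn {A : Set X} {n : ℕ} {c : Chain ρ n} (hc : c ∈ chainsIn ρ A n) :
    chainMap h n c ∈ chainsIn ρ' A n := by
  intro σ hσ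
  refine hc σ fun h0 => hσ ?_
  rw [chainMap_apply, h0, map_zero]

theorem mem_chainsIn_of_chainMap (hinj : Function.Injective (algebraMap R R')) {A : Set X}
    {n : ℕ} {c : Chain ρ n} (hc : chainMap h n c ∈ chainsIn ρ' A n) : c ∈ chainsIn ρ A n := by
  intro σ hσ
  refine hc σ fun h0 => hσ (fibreMap_injective h hinj _ ?_)
  rwa [map_zero]

theorem chainMap_mem_relCycles {A : Set X} {c : Chain ρ 1} (hc : c ∈ relCycles ρ A) :
    chainMap h 1 c ∈ relCycles ρ' A := by
  change boundary ρ' 0 (chainMap h 1 c) ∈ chainsIn ρ' A 0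
  rw [boundary_chainMap]
  exact chainMap_mem_chainsIn h hc

theorem mem_relCycles_of_chainMap (hinj : Function.Injective (algebraMap R R')) {A : Set X}
    {c : Chain ρ 1} (hc : chainMap h 1 c ∈ relCycles ρ' A) : c ∈ relCycles ρ A := by
  refine mem_chainsIn_of_chainMap h hinj ?_
  rw [← boundary_chainMap]
  exact hc

theorem chainMap_mem_relBoundaries {A : Set X} {c : Chain ρ 1} (hc : c ∈ relBoundaries ρ A) :
    chainMap h 1 c ∈ relBoundaries ρ' A := by
  obtain ⟨_, ⟨d, rfl⟩, e, he, rfl⟩ := Submodule.mem_sup.1 hc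
  rw [map_add, ← boundary_chainMap]
  exact Submodule.add_mem_sup ⟨_, rfl⟩ (chainMap_mem_chainsIn h he)

/-- Relative boundaries over a localization are fractions of relative boundaries. -/
theorem exists_smul_mem_relBoundaries (hinj : Function.Injective (algebraMap R R'))
    (M : Submonoid R) [IsLocalization M R'] {A : Set X} {c : Chain ρ 1}
    (hc : chainMap h 1 c ∈ relBoundaries ρ' A) : ∃ m ∈ M, m • c ∈ relBoundaries ρ A := by
  obtain ⟨_, ⟨d, rfl⟩, e, he, hde⟩ := Submodule.mem_sup.1 hc
  obtain ⟨m, hm, d', hd'⟩ := exists_chainMap_eq_smul h M 2 d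
  refine ⟨m, hm, ?_⟩
  have h1 : chainMap h 1 (m • c - boundary ρ 1 d') = algebraMap R R' m • e := by
    rw [map_sub, LinearMap.map_smulₛₗ, ← boundary_chainMap, hd', ← hde, map_smul, smul_add,
      add_sub_cancel_left]
  have h2 : m • c - boundary ρ 1 d' ∈ chainsIn ρ A 1 := by
    refine mem_chainsIn_of_chainMap h hinj ?_
    rw [h1]
    exact Submodule.smul_mem _ _ he
  rw [← add_sub_cancel (boundary ρ 1 d') (m • c)]
  exact Submodule.add_mem_sup ⟨_, rfl⟩ h2

/-- The map of relative homology induced by extension of scalars from `R` to `R'`. -/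
def relH1Map (A : Set X) : relH1 ρ A →ₛₗ[algebraMap R R'] relH1 ρ' A :=
  Submodule.mapQ _ _
    (((chainMap h 1).comp (relCycles ρ A).subtype).codRestrict (relCycles ρ' A)
      fun c => chainMap_mem_relCycles h c.2)
    fun _ hc => chainMap_mem_relBoundaries h hc

theorem exists_relH1Map_eq_smul (hinj : Function.Injective (algebraMap R R'))
    (M : Submonoid R) [IsLocalization M R'] (A : Set X) (y : relH1 ρ' A) :
    ∃ m ∈ M, ∃ z, relH1Map h A z = algebraMap R R' m • y := by
  obtain ⟨c, rfl⟩ := Submodule.Quotient.mk_surjective _ y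
  obtain ⟨m, hm, d, hd⟩ := exists_chainMap_eq_smul h M 1 c.1
  have hd' : d ∈ relCycles ρ A := by
    refine mem_relCycles_of_chainMap h hinj ?_
    rw [hd]
    exact Submodule.smul_mem _ _ c.2
  refine ⟨m, hm, Submodule.Quotient.mk ⟨d, hd'⟩, ?_⟩
  exact congrArg Submodule.Quotient.mk (Subtype.ext hd :
    (⟨chainMap h 1 d, chainMap_mem_relCycles h hd'⟩ : relCycles ρ' A) = algebraMap R R' m • c)

theorem exists_smul_eq_zero_of_relH1Map (hinj : Function.Injective (algebraMap R R'))
    (M : Submonoid R) [IsLocalization M R'] (A : Set X) (z : relH1 ρ A)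
    (hz : relH1Map h A z = 0) : ∃ m ∈ M, m • z = 0 := by
  obtain ⟨c, rfl⟩ := Submodule.Quotient.mk_surjective _ z
  have h0 : (Submodule.Quotient.mk ⟨chainMap h 1 c.1, chainMap_mem_relCycles h c.2⟩ :
      relH1 ρ' A) = 0 := hz
  rw [Submodule.Quotient.mk_eq_zero] at h0
  have h1 : chainMap h 1 c.1 ∈ relBoundaries ρ' A := h0
  obtain ⟨m, hm, h2⟩ := exists_smul_mem_relBoundaries h hinj M h1
  exact ⟨m, hm, (Submodule.Quotient.mk_eq_zero _).2 h2⟩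

end Localization

section Presentation

variable {R R' : Type*} [CommRing R] [CommRing R'] [Algebra R R']

/-- A presentation of a module presents its localization. -/
theorem IsPresentation.of_isLocalization (M : Submonoid R) [IsLocalization M R']
    {N N' : Type*} [AddCommGroup N] [Module R N] [AddCommGroup N'] [Module R' N']
    (L : N →ₛₗ[algebraMap R R'] N')
    (hsurj : ∀ y, ∃ m ∈ M, ∃ z, L z = algebraMap R R' m • y)
    (hker : ∀ z, L z = 0 → ∃ m ∈ M, m • z = 0)
    {n q : ℕ} {Φ : Matrix (Fin n) (Fin q) R} (hΦ : IsPresentation Φ N) :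
    IsPresentation (Φ.map (algebraMap R R')) N' := by
  obtain ⟨π, hπ, hπk⟩ := hΦ
  have hunit {m : R} (hm : m ∈ M) : IsUnit (algebraMap R R' m) :=
    IsLocalization.map_units R' ⟨m, hm⟩
  let π' : (Fin n → R') →ₗ[R'] N' := Fintype.linearCombination R' fun i => L (π (Pi.single i 1))
  have hLπ (v : Fin n → R) : L (π v) = π' fun i => algebraMap R R' (v i) := by
    conv_lhs => rw [pi_eq_sum_univ' v]
    simp only [map_sum, map_smul, LinearMap.map_smulₛₗ, π', Fintype.linearCombination_apply]
  have hclear {ι : Type} [Finite ι] (w : ι → R') :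
      ∃ m ∈ M, ∃ v : ι → R, (fun i => algebraMap R R' (v i)) = algebraMap R R' m • w := by
    obtain ⟨b, hb⟩ := IsLocalization.exist_integer_multiples_of_finite M w
    choose v hv using hb
    refine ⟨b, b.2, v, funext fun i => ?_⟩
    rw [hv, Pi.smul_apply, Algebra.smul_def, smul_eq_mul]
  have hΦmul (v : Fin q → R) : (Φ.map (algebraMap R R')).mulVec (fun j => algebraMap R R' (v j)) =
      fun i => algebraMap R R' (Φ.mulVec v i) := by
    funext i
    exact (RingHom.map_mulVec (algebraMap R R') Φ v i).symm
  refine ⟨π', fun y => ?_, le_antisymm (fun w hw => ?_) ?_⟩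
  · obtain ⟨m, hm, z, hz⟩ := hsurj y
    obtain ⟨v, rfl⟩ := hπ z
    refine ⟨(hunit hm).unit⁻¹.1 • fun i => algebraMap R R' (v i), ?_⟩
    rw [map_smul, ← hLπ, hz, smul_smul, IsUnit.val_inv_mul, one_smul]
  · obtain ⟨m, hm, v, hv⟩ := hclear w
    have h1 : L (π v) = 0 := by
      rw [hLπ, hv, map_smul, LinearMap.mem_ker.1 hw, smul_zero]
    obtain ⟨m', hm', h2⟩ := hker _ h1
    rw [← map_smul, ← LinearMap.mem_ker, hπk] at h2
    obtain ⟨u, hu⟩ := h2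
    have h3 : algebraMap R R' (m' * m) • w =
        (Φ.map (algebraMap R R')).mulVecLin (fun j => algebraMap R R' (u j)) := by
      rw [Matrix.mulVecLin_apply, hΦmul, map_mul, mul_smul, ← hv]
      rw [Matrix.mulVecLin_apply] at hu
      rw [hu]
      funext i
      simp
    have hu' := hunit (M.mul_mem hm' hm)
    refine ⟨hu'.unit⁻¹.1 • (fun j => algebraMap R R' (u j)), ?_⟩
    rw [map_smul, ← h3, smul_smul, IsUnit.val_inv_mul, one_smul]
  · rintro _ ⟨w, rfl⟩
    obtain ⟨m, hm, v, hv⟩ := hclear w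
    have h1 : algebraMap R R' m • π' ((Φ.map (algebraMap R R')).mulVecLin w) = 0 := by
      have h2 : π (Φ.mulVec v) = 0 := by
        rw [← LinearMap.mem_ker, hπk]
        exact ⟨v, rfl⟩
      rw [← map_smul, ← map_smul, ← hv, Matrix.mulVecLin_apply, hΦmul, ← hLπ, h2, map_zero]
    exact (hunit hm).smul_eq_zero.1 h1

end Presentation

/-! ### Elementary ideals through alternating forms -/

section Minors

variable {R : Type*} [CommRing R]

/-- A multilinear form takes values in an ideal on the span of `g` as soon as it does so
on `g`. -/
theorem multilinear_mem_ideal {M ι κ : Type*} [AddCommGroup M] [Module R M] [Fintype ι]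
    [Fintype κ] (f : MultilinearMap R (fun _ : ι => M) R) (I : Ideal R)
    (g : κ → M) (hg : ∀ r : ι → κ, f (g ∘ r) ∈ I) (v : ι → M)
    (hv : ∀ i, v i ∈ Submodule.span R (Set.range g)) : f v ∈ I := by
  classical
  have h (i : ι) : ∃ w : κ → R, ∑ j, w j • g j = v i :=
    (Submodule.mem_span_range_iff_exists_fun R).1 (hv i)
  choose w hw using h
  rw [← funext hw, f.map_sum]
  refine sum_mem fun r _ => ?_
  rw [f.map_smul_univ (fun i => w i (r i)) (fun i => g (r i)), smul_eq_mul]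
  exact I.mul_mem_left _ (hg r)

/-- The determinant of the square matrix with first row `u` as a form in the other rows. -/
def detCons {n : ℕ} (u : Fin (n + 1) → R) : (Fin (n + 1) → R) [⋀^Fin n]→ₗ[R] R :=
  Matrix.detRowAlternating.curryLeft u

theorem detCons_apply {n : ℕ} (u : Fin (n + 1) → R) (v : Fin n → Fin (n + 1) → R) :
    detCons u v = (Matrix.of (Fin.cons u v : Fin (n + 1) → Fin (n + 1) → R)).det := rfl

theorem detCons_eq_sum {n : ℕ} (u : Fin (n + 1) → R) (v : Fin n → Fin (n + 1) → R) :
    detCons u v = ∑ j : Fin (n + 1), (-1) ^ (j : ℕ) * u j *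
      (Matrix.of fun i k => v i (j.succAbove k)).det := by
  rw [detCons_apply, Matrix.det_succ_row_zero]
  rfl

/-- The first elementary ideal in terms of the submodule of relations: it is generated by the
determinants all of whose rows but the first are relations. -/
theorem minorIdeal_one_eq {n q : ℕ} (Φ : Matrix (Fin (n + 1)) (Fin q) R) :
    minorIdeal 1 Φ = Ideal.span {d | ∃ (u : Fin (n + 1) → R) (v : Fin n → Fin (n + 1) → R),
      (∀ i, v i ∈ LinearMap.range Φ.mulVecLin) ∧ d = detCons u v} := by
  apply le_antisymm
  · refine Ideal.span_le.2 ?_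
    rintro _ ⟨r, c, rfl⟩
    change Fin n → Fin (n + 1) at r
    change Fin n → Fin q at c
    by_cases hr : Function.Injective r
    · obtain ⟨k, hk⟩ : ∃ k, ∀ i, r i ≠ k := by
        by_contra! hcon
        simpa using Fintype.card_le_of_surjective r hcon
      choose σ hσ using fun i => Fin.exists_succAbove_eq (hk i)
      have hσi : Function.Injective σ := fun i j hij => hr (by rw [← hσ, ← hσ, hij])
      let τ : Equiv.Perm (Fin n) :=
        Equiv.ofBijective σ (Finite.injective_iff_bijective.1 hσi)
      have h1 : (Φ.submatrix r c).det = Equiv.Perm.sign τ * ((-1) ^ (k : ℕ) *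
          detCons (Pi.single k 1) fun i l => Φ l (c i)) := by
        have h2 : Φ.submatrix r c = (Φ.submatrix k.succAbove c).submatrix τ id := by
          ext i j
          change Φ (r i) (c j) = Φ (k.succAbove (σ i)) (c j)
          rw [hσ]
        rw [h2, Matrix.det_permute, detCons_eq_sum, Finset.sum_eq_single k]
        · rw [Pi.single_eq_same, mul_one, ← mul_assoc ((-1) ^ (k : ℕ)), ← mul_pow]
          rw [neg_one_mul, neg_neg, one_pow, one_mul, ← Matrix.det_transpose]
          rfl
        · intro j _ hj
          rw [Pi.single_eq_of_ne hj, mul_zero, zero_mul]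
        · intro h
          exact absurd (Finset.mem_univ k) h
      change (Φ.submatrix r c).det ∈ _
      rw [h1]
      refine Ideal.mul_mem_left _ _ (Ideal.mul_mem_left _ _ (Ideal.subset_span ⟨_, _, ?_, rfl⟩))
      intro i
      refine ⟨Pi.single (c i) 1, ?_⟩
      rw [Matrix.mulVecLin_apply, Matrix.mulVec_single_one]
      rfl
    · have h0 : (Φ.submatrix r c).det = 0 := by
        obtain ⟨i, j, hij, hne⟩ := Function.not_injective_iff.1 hr
        refine Matrix.det_zero_of_row_eq hne ?_
        funext l
        change Φ (r i) (c l) = Φ (r j) (c l)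
        rw [hij]
      change (Φ.submatrix r c).det ∈ _
      rw [h0]
      exact zero_mem _
  · refine Ideal.span_le.2 ?_
    rintro _ ⟨u, v, hv, rfl⟩
    refine multilinear_mem_ideal (detCons u).toMultilinearMap _ Φ.col (fun c => ?_) v ?_
    · change detCons u (fun i => Φ.col (c i)) ∈ _
      rw [detCons_eq_sum]
      refine sum_mem fun j _ => Ideal.mul_mem_left _ _ (Ideal.subset_span ⟨j.succAbove, c, ?_⟩)
      rw [← Matrix.det_transpose]
      rfl
    · intro i
      rw [← Matrix.range_mulVecLin]
      exact hv i

theorem minorIdeal_map {R' : Type*} [CommRing R'] (f : R →+* R') {n q : ℕ} (i : ℕ)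
    (Φ : Matrix (Fin n) (Fin q) R) : minorIdeal i (Φ.map f) = (minorIdeal i Φ).map f := by
  rw [minorIdeal, minorIdeal, Ideal.map_span]
  congr 1
  ext d
  constructor
  · rintro ⟨r, c, rfl⟩
    exact ⟨_, ⟨r, c, rfl⟩, f.map_det _⟩
  · rintro ⟨_, ⟨r, c, rfl⟩, rfl⟩
    exact ⟨r, c, f.map_det _⟩

end Minors

section PID

variable {R : Type*} [CommRing R] [IsDomain R] [IsPrincipalIdealRing R]

/-- If a module `N'` over a principal ideal domain is an extension of `R` by a torsion module `N`,
then the first elementary ideal of `N'` is the order ideal of `N`. -/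
theorem exists_minorIdeal_one_eq {n q : ℕ} {Φ : Matrix (Fin n) (Fin q) R}
    {N N' : Type*} [AddCommGroup N] [Module R N] [AddCommGroup N'] [Module R N']
    (hΦ : IsPresentation Φ N') (ι : N →ₗ[R] N') (hι : Function.Injective ι)
    (f : N' →ₗ[R] R) (hf : Function.Surjective f) (hex : LinearMap.range ι = LinearMap.ker f)
    (htors : Module.IsTorsion R N) :
    ∃ (k : ℕ) (a : Fin k → R), (∀ i, a i ≠ 0) ∧ minorIdeal 1 Φ = Ideal.span {∏ i, a i} ∧
      Nonempty (N ≃ₗ[R] ∀ i, R ⧸ Ideal.span {a i}) := by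
  obtain ⟨π, hπ, hker⟩ := hΦ
  obtain ⟨e, he⟩ : ∃ e, (f ∘ₗ π) e = 1 := (hf.comp hπ) 1
  obtain ⟨n, rfl⟩ : ∃ k, n = k + 1 := by
    refine Nat.exists_eq_succ_of_ne_zero ?_
    rintro rfl
    rw [Subsingleton.elim e 0, map_zero] at he
    exact zero_ne_one he
  let F : Submodule R (Fin (n + 1) → R) := LinearMap.ker (f ∘ₗ π)
  let P : Submodule R F := (LinearMap.range Φ.mulVecLin).comap F.subtype
  have hPle : LinearMap.range Φ.mulVecLin ≤ F := by
    rw [← hker]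
    exact LinearMap.ker_le_ker_comp π f
  -- `N` is the quotient of `F` by the relations.
  have hN : Nonempty (N ≃ₗ[R] F ⧸ P) := by
    let g : F →ₗ[R] LinearMap.range ι :=
      (π ∘ₗ F.subtype).codRestrict (LinearMap.range ι) fun x => by
        rw [hex]
        exact x.2
    have hg : Function.Surjective g := by
      rintro ⟨y, hy⟩
      obtain ⟨x, rfl⟩ := hπ y
      rw [hex] at hy
      exact ⟨⟨x, hy⟩, rfl⟩
    have hgk : LinearMap.ker g = P := by
      ext x
      rw [LinearMap.ker_codRestrict]
      change π x.1 = 0 ↔ x.1 ∈ LinearMap.range Φ.mulVecLin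
      rw [← hker]
      rfl
    exact ⟨(LinearEquiv.ofInjective ι hι).trans ((Submodule.quotEquivOfEq _ _ hgk.symm).trans
      (g.quotKerEquivOfSurjective hg)).symm⟩
  obtain ⟨eN⟩ := hN
  have hrank : Module.finrank R P = Module.finrank R F := by
    have h1 : Module.finrank R (F ⧸ P) = 0 := by
      rw [Module.finrank_eq_zero_iff_isTorsion]
      intro x
      obtain ⟨a, ha⟩ := @htors (eN.symm x)
      refine ⟨a, eN.symm.injective ?_⟩
      rw [map_zero, ← ha]
      exact map_smul eN.symm (a : R) x
    have h2 := P.finrank_quotient_add_finrank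
    omega
  have hli : ∀ (c : R), ∀ x ∈ F, c • e + x = 0 → c = 0 := by
    intro c x hx hcx
    have h1 := congrArg (f ∘ₗ π) hcx
    rwa [map_add, map_smul, he, LinearMap.mem_ker.1 hx, add_zero, smul_eq_mul, mul_one,
      map_zero] at h1
  have hsp : ∀ z, ∃ c : R, z + c • e ∈ F := fun z => ⟨-(f ∘ₗ π) z, by
    rw [LinearMap.mem_ker, map_add, map_smul, he, smul_eq_mul, mul_one, add_neg_cancel]⟩
  have hn : Module.finrank R F = n := by
    have h1 := Module.finrank_eq_card_basis
      (Module.Basis.mkFinCons e (Module.finBasis R F) hli hsp)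
    simpa using h1.symm
  let b₀ : Module.Basis (Fin n) R F := Module.finBasisOfFinrankEq R F hn
  let b := Submodule.smithNormalFormTopBasis b₀ hrank
  let a := Submodule.smithNormalFormCoeffs b₀ hrank
  let b' := Submodule.smithNormalFormBotBasis b₀ hrank
  have hb' (i : Fin n) : ((b' i : F) : Fin (n + 1) → R) = a i • (b i : Fin (n + 1) → R) :=
    congrArg Subtype.val (Submodule.smithNormalFormBotBasis_def b₀ hrank i)
  have hspan : LinearMap.range Φ.mulVecLin =
      Submodule.span R (Set.range fun i => a i • (b i : Fin (n + 1) → R)) := by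
    have h1 := congrArg (Submodule.map (F.subtype ∘ₗ P.subtype)) b'.span_eq
    rw [Submodule.map_span, ← Set.range_comp, Submodule.map_top, LinearMap.range_comp,
      Submodule.range_subtype, Submodule.map_comap_subtype, inf_eq_right.2 hPle] at h1
    rw [← h1]
    congr 2
    funext i
    exact hb' i
  have hunit : IsUnit (detCons e fun i => (b i : Fin (n + 1) → R)) := by
    have h1 := (Pi.basisFun R (Fin (n + 1))).isUnit_det (Module.Basis.mkFinCons e b hli hsp)
    rwa [Module.Basis.coe_mkFinCons, Pi.basisFun_det] at h1
  have hprod (u : Fin (n + 1) → R) (r : Fin n → Fin n) :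
      detCons u (fun i => a (r i) • (b (r i) : Fin (n + 1) → R)) =
        (∏ i, a (r i)) * detCons u (fun i => (b (r i) : Fin (n + 1) → R)) :=
    (detCons u).toMultilinearMap.map_smul_univ _ _
  refine ⟨n, a, fun i hi => ?_, ?_, ⟨eN.trans (P.quotientEquivPiSpan b₀ hrank)⟩⟩
  · refine b'.ne_zero i (Subtype.ext (Subtype.ext ?_))
    rw [hb', hi, zero_smul]
    rfl
  · rw [minorIdeal_one_eq]
    apply le_antisymm
    · refine Ideal.span_le.2 ?_
      rintro _ ⟨u, v, hv, rfl⟩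
      refine multilinear_mem_ideal (detCons u).toMultilinearMap _ _ (fun r => ?_) v
        (fun i => hspan ▸ hv i)
      change detCons u (fun i => a (r i) • (b (r i) : Fin (n + 1) → R)) ∈ _
      rw [hprod]
      by_cases hr : Function.Injective r
      · have h1 : ∏ i, a (r i) = ∏ i, a i :=
          (Finite.injective_iff_bijective.1 hr).prod_comp a
        rw [h1]
        exact Ideal.mul_mem_right _ _ (Ideal.mem_span_singleton_self _)
      · obtain ⟨i, j, hij, hne⟩ := Function.not_injective_iff.1 hr
        rw [(detCons u).map_eq_zero_of_eq _ (by rw [hij]) hne, mul_zero]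
        exact zero_mem _
    · rw [Ideal.span_singleton_le_iff_mem]
      refine (Ideal.mul_unit_mem_iff_mem _ hunit).1 ?_
      refine Ideal.subset_span ⟨e, fun i => a i • (b i : Fin (n + 1) → R), fun i => ?_, ?_⟩
      · rw [hspan]
        exact Submodule.subset_span ⟨i, rfl⟩
      · exact (hprod e id).symm

end PID

/-! ### Group rings graded by a homomorphism to the integers -/

section Graded

open Polynomial

variable {Γ : Type*} [CommGroup Γ] (ψ : Γ →* Multiplicative ℤ) (t : Γ)

theorem kerInclusion_single (g : ψ.ker) (c : ℤ) :
    kerInclusion ψ (MonoidAlgebra.single g c) = MonoidAlgebra.single (g : Γ) c :=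
  MonoidAlgebra.mapDomain_single

theorem kerInclusion_injective : Function.Injective (kerInclusion ψ) :=
  MonoidAlgebra.mapDomain_injective ψ.ker.subtype_injective

/-- The homomorphism `ℤ[ker ψ][X] → ℤ[Γ]` that maps `X` to `t`. -/
def ofKerPoly : (MonoidAlgebra ℤ ψ.ker)[X] →+* MonoidAlgebra ℤ Γ :=
  eval₂RingHom (kerInclusion ψ) (MonoidAlgebra.single t 1)

theorem ofKerPoly_monomial_single (n : ℕ) (g : ψ.ker) (c : ℤ) :
    ofKerPoly ψ t (monomial n (MonoidAlgebra.single g c)) =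
      MonoidAlgebra.single ((g : Γ) * t ^ n) c := by
  change eval₂ _ _ _ = _
  rw [eval₂_monomial, kerInclusion_single, MonoidAlgebra.single_pow, one_pow,
    MonoidAlgebra.single_mul_single, mul_one]

theorem poly_induction {P : (MonoidAlgebra ℤ ψ.ker)[X] → Prop} (p : (MonoidAlgebra ℤ ψ.ker)[X])
    (h0 : P 0) (h1 : ∀ n g c, P (monomial n (MonoidAlgebra.single g c)))
    (h2 : ∀ p q, P p → P q → P (p + q)) : P p := by
  induction p using Polynomial.induction_on' with
  | add p q hp hq => exact h2 p q hp hq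
  | monomial n b =>
    induction b using MonoidAlgebra.induction_linear with
    | zero => rwa [map_zero]
    | add b c hb hc =>
      rw [map_add]
      exact h2 _ _ hb hc
    | single g c => exact h1 n g c

variable {ψ t} (ht : ψ t = Multiplicative.ofAdd 1)

include ht in
theorem toAdd_apply_mul_pow (g : ψ.ker) (n : ℕ) :
    Multiplicative.toAdd (ψ ((g : Γ) * t ^ n)) = n := by
  rw [map_mul, map_pow, ht, MonoidHom.mem_ker.1 g.2, one_mul, toAdd_pow, toAdd_ofAdd]
  simp

include ht in
theorem mul_pow_eq_iff (g h : ψ.ker) (m n : ℕ) :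
    (g : Γ) * t ^ m = h * t ^ n ↔ m = n ∧ g = h := by
  constructor
  · intro heq
    have h1 : m = n := by
      have h2 := congrArg (fun x => Multiplicative.toAdd (ψ x)) heq
      beta_reduce at h2
      rw [toAdd_apply_mul_pow ht, toAdd_apply_mul_pow ht] at h2
      exact_mod_cast h2
    subst h1
    exact ⟨rfl, Subtype.ext (mul_right_cancel heq)⟩
  · rintro ⟨rfl, rfl⟩
    rfl

include ht in
theorem coeff_ofKerPoly (p : (MonoidAlgebra ℤ ψ.ker)[X]) (g : ψ.ker) (n : ℕ) :
    (ofKerPoly ψ t p).coeff ((g : Γ) * t ^ n) = (p.coeff n).coeff g := by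
  classical
  induction p using poly_induction with
  | h0 => simp
  | h2 p q hp hq => simp [hp, hq]
  | h1 m h c =>
    rw [ofKerPoly_monomial_single, MonoidAlgebra.coeff_single, Finsupp.single_apply, coeff_monomial]
    by_cases hm : m = n
    · simp [mul_pow_eq_iff ht, hm, MonoidAlgebra.coeff_single, Finsupp.single_apply]
    · simp [mul_pow_eq_iff ht, hm]

include ht in
theorem ofKerPoly_injective : Function.Injective (ofKerPoly ψ t) := by
  rw [injective_iff_map_eq_zero]
  intro p hp
  ext n g
  rw [← coeff_ofKerPoly ht, hp]
  simp

include ht in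
theorem exists_ker_mul_pow (h : Γ) (h0 : 0 ≤ Multiplicative.toAdd (ψ h)) :
    ∃ (g : ψ.ker) (n : ℕ), h = (g : Γ) * t ^ n := by
  obtain ⟨n, hn⟩ := Int.eq_ofNat_of_zero_le h0
  refine ⟨⟨h * (t ^ n)⁻¹, ?_⟩, n, (inv_mul_cancel_right _ _).symm⟩
  rw [MonoidHom.mem_ker, map_mul, map_inv, map_pow, ht]
  apply Multiplicative.toAdd.injective
  simp [hn]

include ht in
theorem exists_ofKerPoly_eq (x : MonoidAlgebra ℤ Γ)
    (hx : ∀ h ∈ x.coeff.support, 0 ≤ Multiplicative.toAdd (ψ h)) :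
    ∃ p, ofKerPoly ψ t p = x := by
  rw [← RingHom.mem_range, ← MonoidAlgebra.sum_coeff_single x]
  refine sum_mem fun h hh => ?_
  obtain ⟨g, n, rfl⟩ := exists_ker_mul_pow ht h (hx h hh)
  exact ⟨_, ofKerPoly_monomial_single ψ t n g _⟩

theorem coeff_mul_single_one_apply (x : MonoidAlgebra ℤ Γ) (g h : Γ) :
    (x * MonoidAlgebra.single g 1).coeff h = x.coeff (h * g⁻¹) := by
  rw [MonoidAlgebra.coeff_mul_single_eq_coeff_mul (h * g⁻¹), mul_one]
  intro a _
  exact eq_mul_inv_iff_mul_eq.symm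

include ht in
theorem exists_pow_mul_eq_ofKerPoly (x : MonoidAlgebra ℤ Γ) :
    ∃ k p, MonoidAlgebra.single t 1 ^ k * x = ofKerPoly ψ t p := by
  obtain ⟨k, hk⟩ : ∃ k : ℕ, ∀ h ∈ x.coeff.support, -(k : ℤ) ≤ Multiplicative.toAdd (ψ h) := by
    refine ⟨x.coeff.support.sup fun h => (Multiplicative.toAdd (ψ h)).natAbs, fun h hh => ?_⟩
    have h1 := Finset.le_sup (f := fun h => (Multiplicative.toAdd (ψ h)).natAbs) hh
    omega
  obtain ⟨p, hp⟩ := exists_ofKerPoly_eq ht (x * MonoidAlgebra.single (t ^ k) 1) (by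
    intro h hh
    rw [Finsupp.mem_support_iff, coeff_mul_single_one_apply, ← Finsupp.mem_support_iff] at hh
    have h1 := hk _ hh
    rw [map_mul, map_inv, map_pow, ht] at h1
    simp at h1
    omega)
  exact ⟨k, p, by rw [hp, mul_comm, MonoidAlgebra.single_pow, one_pow]⟩

include ht in
/-- A non-zero element of `ℤ[Γ]` is, up to a monomial factor, a polynomial in `t` over `ℤ[ker ψ]`
with non-zero constant coefficient, whose degree is the width of the `ψ`-grading. -/
theorem exists_ofKerPoly_natDegree (x : MonoidAlgebra ℤ Γ) (hx : x.coeff.support.Nonempty) :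
    ∃ p : (MonoidAlgebra ℤ ψ.ker)[X], p.coeff 0 ≠ 0 ∧
      (∃ g : Γ, ofKerPoly ψ t p = x * MonoidAlgebra.single g 1) ∧
      p.natDegree = (x.coeff.support.sup' hx (fun h => Multiplicative.toAdd (ψ h)) -
        x.coeff.support.inf' hx (fun h => Multiplicative.toAdd (ψ h))).toNat := by
  set a := x.coeff.support.sup' hx (fun h => Multiplicative.toAdd (ψ h)) with ha
  set b := x.coeff.support.inf' hx (fun h => Multiplicative.toAdd (ψ h)) with hb
  have hle : ∀ h ∈ x.coeff.support, Multiplicative.toAdd (ψ h) ≤ a := fun h hh =>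
    Finset.le_sup' (fun h => Multiplicative.toAdd (ψ h)) hh
  have hge : ∀ h ∈ x.coeff.support, b ≤ Multiplicative.toAdd (ψ h) := fun h hh =>
    Finset.inf'_le (fun h => Multiplicative.toAdd (ψ h)) hh
  obtain ⟨ha', hha, hha'⟩ := Finset.exists_mem_eq_sup' hx (fun h => Multiplicative.toAdd (ψ h))
  obtain ⟨hb', hhb, hhb'⟩ := Finset.exists_mem_eq_inf' hx (fun h => Multiplicative.toAdd (ψ h))
  rw [← ha] at hha'
  rw [← hb] at hhb'
  have hψt (k : ℤ) : Multiplicative.toAdd (ψ (t ^ k)) = k := by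
    rw [map_zpow, ht]
    simp
  have hmem (h : Γ) : h ∈ (x * MonoidAlgebra.single (t ^ (-b)) 1).coeff.support ↔
      h * t ^ b ∈ x.coeff.support := by
    rw [Finsupp.mem_support_iff, coeff_mul_single_one_apply, ← Finsupp.mem_support_iff, zpow_neg,
      inv_inv]
  have hdeg (h : Γ) : Multiplicative.toAdd (ψ (h * t ^ b)) = Multiplicative.toAdd (ψ h) + b := by
    rw [map_mul, toAdd_mul, hψt]
  obtain ⟨p, hp⟩ := exists_ofKerPoly_eq ht (x * MonoidAlgebra.single (t ^ (-b)) 1) (by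
    intro h hh
    have h1 := hge _ ((hmem h).1 hh)
    rw [hdeg] at h1
    omega)
  -- Every exponent in the support of `x` gives a non-zero coefficient, and conversely.
  have hne (h : Γ) (hh : h ∈ x.coeff.support) (n : ℕ)
      (hn : (n : ℤ) = Multiplicative.toAdd (ψ h) - b) : p.coeff n ≠ 0 := by
    have h1 : (h * t ^ (-b)) * t ^ b = h := by
      rw [mul_assoc, ← zpow_add, neg_add_cancel, zpow_zero, mul_one]
    have h2 := hdeg (h * t ^ (-b))
    rw [h1] at h2
    obtain ⟨g, m, hg⟩ := exists_ker_mul_pow ht (h * t ^ (-b)) (by have := hge h hh; omega)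
    have h3 : m = n := by
      rw [hg, toAdd_apply_mul_pow ht] at h2
      omega
    subst h3
    intro h0
    have h4 := coeff_ofKerPoly ht p g m
    rw [h0, hp, ← hg] at h4
    exact Finsupp.mem_support_iff.1 ((hmem _).2 (by rwa [h1])) h4
  refine ⟨p, hne hb' hhb 0 (by omega), ⟨_, hp⟩, ?_⟩
  have hab : b ≤ a := hhb' ▸ hle hb' hhb
  apply le_antisymm
  · refine natDegree_le_iff_coeff_eq_zero.2 fun n hn => ?_
    ext g
    rw [← coeff_ofKerPoly ht, hp]
    by_contra h0
    have h1 := hle _ ((hmem _).1 (Finsupp.mem_support_iff.2 h0))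
    rw [hdeg, toAdd_apply_mul_pow ht] at h1
    omega
  · refine le_natDegree_of_ne_zero (hne ha' hha _ ?_)
    rw [← hha']
    omega

end Graded

/-! ### Laurent polynomial rings over a field -/

section Laurent

open Polynomial

variable {K R : Type*} [Field K] [CommRing R] [Algebra K R]

/-- `R` is the ring of Laurent polynomials in `T` over `K`. -/
structure IsLaurent (K : Type*) {R : Type*} [Field K] [CommRing R] [Algebra K R] (T : R) :
    Prop where
  isUnit : IsUnit T
  injective : Function.Injective (aeval T : K[X] →ₐ[K] R)
  surj : ∀ r : R, ∃ (k : ℕ) (p : K[X]), T ^ k * r = aeval T p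

namespace IsLaurent

variable {T : R} (hT : IsLaurent K T)

include hT

theorem isPrincipalIdealRing : IsPrincipalIdealRing R := by
  refine ⟨fun I => ?_⟩
  obtain ⟨p, hp⟩ := (IsPrincipalIdealRing.principal (I.comap (aeval T : K[X] →ₐ[K] R))).principal
  have hmem (q : K[X]) : aeval T q ∈ I ↔ p ∣ q := by
    rw [← Ideal.mem_comap, hp, Ideal.submodule_span_eq, Ideal.mem_span_singleton]
  refine ⟨aeval T p, le_antisymm (fun r hr => ?_) ?_⟩
  · obtain ⟨k, q, hq⟩ := hT.surj r
    have h1 : aeval T q ∈ I := hq ▸ I.mul_mem_left _ hr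
    rw [Ideal.submodule_span_eq, Ideal.mem_span_singleton, ← (hT.isUnit.pow k).dvd_mul_left, hq]
    exact map_dvd _ ((hmem q).1 h1)
  · rw [Ideal.submodule_span_eq, Ideal.span_singleton_le_iff_mem, hmem]

theorem exists_eq_unit_mul {r : R} (hr : r ≠ 0) :
    ∃ p : K[X], p.coeff 0 ≠ 0 ∧ Associated (aeval T p) r := by
  obtain ⟨k, q, hq⟩ := hT.surj r
  have hq0 : q ≠ 0 := by
    rintro rfl
    rw [map_zero] at hq
    exact hr ((hT.isUnit.pow k).mul_right_eq_zero.1 hq)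
  obtain ⟨p, hp, hdvd⟩ := exists_eq_pow_rootMultiplicity_mul_and_not_dvd q hq0 0
  rw [C_0, sub_zero] at hp hdvd
  refine ⟨p, fun h0 => hdvd (X_dvd_iff.2 h0), ?_⟩
  have h1 : Associated (aeval T q) r := by
    rw [← hq]
    exact associated_unit_mul_left _ _ (hT.isUnit.pow k)
  refine Associated.trans ?_ h1
  rw [hp, map_mul, map_pow, aeval_X]
  exact (associated_unit_mul_left _ _ (hT.isUnit.pow _)).symm

theorem nonempty_quotient_equiv {p : K[X]} (hp : p.coeff 0 ≠ 0) :
    Nonempty ((K[X] ⧸ Ideal.span {p}) ≃ₗ[K] R ⧸ Ideal.span {aeval T p}) := by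
  let f : K[X] →ₐ[K] R ⧸ Ideal.span {aeval T p} :=
    (Ideal.Quotient.mkₐ K (Ideal.span {aeval T p})).comp (aeval T)
  have hcop : IsCoprime p X := by
    rw [isCoprime_comm, (prime_X (R := K)).coprime_iff_not_dvd, X_dvd_iff]
    exact hp
  have hker : RingHom.ker f = Ideal.span {p} := by
    ext q
    rw [RingHom.mem_ker, Ideal.mem_span_singleton]
    change Ideal.Quotient.mk _ (aeval T q) = 0 ↔ _
    rw [Ideal.Quotient.eq_zero_iff_mem, Ideal.mem_span_singleton]
    constructor
    · rintro ⟨r, hr⟩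
      obtain ⟨k, s, hs⟩ := hT.surj r
      have h1 : X ^ k * q = p * s := by
        apply hT.injective
        rw [map_mul, map_mul, map_pow, aeval_X, hr, ← hs]
        ring
      exact (hcop.pow_right (n := k)).dvd_of_dvd_mul_left ⟨s, h1⟩
    · exact map_dvd _
  have hsurj : Function.Surjective f := by
    have hX : IsUnit (f X) := by
      change IsUnit (Ideal.Quotient.mk _ (aeval T X))
      rw [aeval_X]
      exact hT.isUnit.map _
    -- Modulo `p` the variable is a unit of `K[X]`, so negative powers of `T` are polynomials.
    obtain ⟨a, b, hab⟩ := hcop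
    have hinv : f b * f X = 1 := by
      have h1 : f p = 0 := by
        rw [← RingHom.mem_ker, hker]
        exact Ideal.mem_span_singleton_self p
      rw [← map_one f, ← hab, map_add, map_mul f a, h1, mul_zero, zero_add, map_mul]
    intro y
    obtain ⟨r, rfl⟩ := Ideal.Quotient.mk_surjective y
    obtain ⟨k, s, hs⟩ := hT.surj r
    refine ⟨b ^ k * s, (hX.pow k).mul_left_cancel ?_⟩
    have h2 : f s = f X ^ k * Ideal.Quotient.mk _ r := by
      change Ideal.Quotient.mk _ (aeval T s) = (Ideal.Quotient.mk _ (aeval T X)) ^ k * _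
      rw [← hs, aeval_X, map_mul, map_pow]
    rw [map_mul, map_pow, ← mul_assoc, ← mul_pow, mul_comm (f X), hinv, one_pow, one_mul, h2]
  exact ⟨((Ideal.quotientEquivAlgOfEq K hker.symm).trans
    (Ideal.quotientKerAlgEquivOfSurjective hsurj)).toLinearEquiv⟩

theorem finite_quotient {p : K[X]} (hp : p.coeff 0 ≠ 0) :
    Module.Finite K (R ⧸ Ideal.span {aeval T p}) := by
  have h0 : p ≠ 0 := by
    rintro rfl
    exact hp (coeff_zero 0)
  obtain ⟨e⟩ := hT.nonempty_quotient_equiv hp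
  have : Module.Finite K (K[X] ⧸ Ideal.span {p}) := (AdjoinRoot.powerBasis h0).finite
  exact Module.Finite.equiv e

theorem finrank_quotient {p : K[X]} (hp : p.coeff 0 ≠ 0) :
    Module.finrank K (R ⧸ Ideal.span {aeval T p}) = p.natDegree := by
  obtain ⟨e⟩ := hT.nonempty_quotient_equiv hp
  rw [← e.finrank_eq, finrank_quotient_span_eq_natDegree]

theorem not_finite : ¬ Module.Finite K R := by
  intro hfin
  obtain ⟨p, hp, h0⟩ := (Algebra.IsIntegral.isIntegral (R := K) T).isAlgebraic
  exact hp (hT.injective (by rw [h0, map_zero]))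

theorem isTorsion [IsDomain R] {N : Type*} [AddCommGroup N] [Module R N] [Module K N]
    [IsScalarTower K R N] [Module.Finite K N] : Module.IsTorsion R N := by
  intro x
  by_contra! hx
  refine hT.not_finite (Module.Finite.of_injective
    ((LinearMap.toSpanSingleton R N x).restrictScalars K) ?_)
  rw [injective_iff_map_eq_zero]
  intro r hr
  by_contra h0
  exact hx ⟨r, mem_nonZeroDivisors_of_ne_zero h0⟩ hr

/-- The dimension of a torsion module is the degree of a generator of its order ideal. -/
theorem rank_eq_natDegree [IsDomain R] {N : Type*} [AddCommGroup N] [Module R N] [Module K N]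
    [IsScalarTower K R N] {k : ℕ} {a : Fin k → R} (ha : ∀ i, a i ≠ 0)
    (e : N ≃ₗ[R] ∀ i, R ⧸ Ideal.span {a i}) {p : K[X]} (hp : p.coeff 0 ≠ 0)
    (hpa : Ideal.span {∏ i, a i} = Ideal.span {aeval T p}) :
    Module.rank K N = p.natDegree := by
  choose b hb hba using fun i => hT.exists_eq_unit_mul (ha i)
  have hspan (i : Fin k) : Ideal.span {a i} = Ideal.span {aeval T (b i)} :=
    Ideal.span_singleton_eq_span_singleton.2 (hba i).symm
  have hfin (i : Fin k) : Module.Finite K (R ⧸ Ideal.span {a i}) := by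
    rw [hspan i]
    exact hT.finite_quotient (hb i)
  let e' : N ≃ₗ[K] ∀ i, R ⧸ Ideal.span {a i} := e.restrictScalars K
  have hN : Module.Finite K N := Module.Finite.equiv e'.symm
  have hprod : (∏ i, b i).coeff 0 ≠ 0 := by
    rw [coeff_zero_prod]
    exact Finset.prod_ne_zero_iff.2 fun i _ => hb i
  have hspan' : Ideal.span {aeval T p} = Ideal.span {aeval T (∏ i, b i)} := by
    rw [← hpa, Ideal.span_singleton_eq_span_singleton, map_prod]
    exact Associated.prod _ _ _ fun i _ => (hba i).symm
  have hdeg : p.natDegree = (∏ i, b i).natDegree := by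
    rw [← hT.finrank_quotient hp, ← hT.finrank_quotient hprod, hspan']
  rw [← Module.finrank_eq_rank, e'.finrank_eq, Module.finrank_pi_fintype, hdeg, natDegree_prod]
  · congr 1
    refine Finset.sum_congr rfl fun i _ => ?_
    rw [hspan i, hT.finrank_quotient (hb i)]
  · intro i _ h0
    exact hb i (by rw [h0, coeff_zero])

end IsLaurent

end Laurent

/-! ### The localized group ring as a Laurent polynomial ring -/

section LocalizedGroupRing

open Polynomial

variable {Γ : Type*} [CommGroup Γ] (ψ : Γ →* Multiplicative ℤ)

section Base

theorem baseInclusion_algebraMap (b : MonoidAlgebra ℤ ψ.ker) :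
    baseInclusion ψ (algebraMap _ (BaseField ψ) b) = algebraMap _ _ (kerInclusion ψ b) :=
  IsLocalization.map_eq _ b

/-- The localization `ℤ[Γ] S⁻¹` as an algebra over `𝕂`. -/
abbrev baseAlgebra : Algebra (BaseField ψ) (LocalizedRing ψ) := (baseInclusion ψ).toAlgebra

variable {ψ} {t : Γ}

theorem aeval_map_eq (p : (MonoidAlgebra ℤ ψ.ker)[X]) :
    letI := baseAlgebra ψ
    aeval (algebraMap (MonoidAlgebra ℤ Γ) (LocalizedRing ψ) (MonoidAlgebra.single t 1))
      (p.map (algebraMap _ (BaseField ψ))) = algebraMap _ _ (ofKerPoly ψ t p) := by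
  let _ := baseAlgebra ψ
  rw [aeval_def, eval₂_map]
  change _ = algebraMap _ (LocalizedRing ψ) (eval₂ _ _ p)
  rw [hom_eval₂]
  congr 1
  exact RingHom.ext fun b => baseInclusion_algebraMap ψ b

end Base

variable [IsDomain (MonoidAlgebra ℤ Γ)]

instance : IsDomain (MonoidAlgebra ℤ ψ.ker) :=
  (kerInclusion_injective ψ).isDomain (kerInclusion ψ)

theorem localizingSet_le_nonZeroDivisors :
    localizingSet ψ ≤ nonZeroDivisors (MonoidAlgebra ℤ Γ) :=
  map_le_nonZeroDivisors_of_injective _ (kerInclusion_injective ψ) le_rfl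

instance : IsDomain (LocalizedRing ψ) :=
  IsLocalization.isDomain_localization (localizingSet_le_nonZeroDivisors ψ)

theorem algebraMap_localizedRing_injective :
    Function.Injective (algebraMap (MonoidAlgebra ℤ Γ) (LocalizedRing ψ)) :=
  IsLocalization.injective _ (localizingSet_le_nonZeroDivisors ψ)

variable {ψ} {t : Γ}

/-- The ring `ℤ[Γ] S⁻¹` is a Laurent polynomial ring over `𝕂` in any `t` with `ψ t = 1`. -/
theorem isLaurent_localizedRing (ht : ψ t = Multiplicative.ofAdd 1) :
    letI := baseAlgebra ψ
    IsLaurent (BaseField ψ)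
      (algebraMap (MonoidAlgebra ℤ Γ) (LocalizedRing ψ) (MonoidAlgebra.single t 1)) := by
  let _ := baseAlgebra ψ
  refine ⟨?_, ?_, ?_⟩
  · refine IsUnit.map _ (IsUnit.of_mul_eq_one (MonoidAlgebra.single t⁻¹ 1) ?_)
    rw [MonoidAlgebra.single_mul_single, mul_inv_cancel, mul_one, MonoidAlgebra.one_def]
  · rw [injective_iff_map_eq_zero]
    intro p hp
    obtain ⟨b, hb, hbp⟩ := IsLocalization.integerNormalization_spec
      (nonZeroDivisors (MonoidAlgebra ℤ ψ.ker)) p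
    have h1 : algebraMap _ (LocalizedRing ψ) (ofKerPoly ψ t (IsLocalization.integerNormalization
        (nonZeroDivisors (MonoidAlgebra ℤ ψ.ker)) p)) = 0 := by
      rw [← aeval_map_eq, hbp, ← algebraMap_smul (BaseField ψ) b p, map_smul, hp, smul_zero]
    rw [map_eq_zero_iff _ (algebraMap_localizedRing_injective ψ),
      map_eq_zero_iff _ (ofKerPoly_injective ht)] at h1
    exact (IsLocalization.integerNormalization_eq_zero_iff le_rfl p).1 h1
  · intro r
    obtain ⟨⟨x, s⟩, hr⟩ := IsLocalization.surj (localizingSet ψ) r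
    obtain ⟨b, hb, hbs⟩ := s.2
    obtain ⟨k, p, hp⟩ := exists_pow_mul_eq_ofKerPoly ht x
    have hb0 : algebraMap _ (BaseField ψ) b ≠ 0 :=
      IsFractionRing.to_map_ne_zero_of_mem_nonZeroDivisors hb
    refine ⟨k, C (algebraMap _ (BaseField ψ) b)⁻¹ * p.map (algebraMap _ (BaseField ψ)), ?_⟩
    have hs : baseInclusion ψ (algebraMap _ (BaseField ψ) b) = algebraMap _ _ s.1 := by
      rw [baseInclusion_algebraMap, ← hbs]
    rw [map_mul, aeval_C, aeval_map_eq, ← hp, map_mul, map_pow, ← hr, ← hs]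
    change _ = baseInclusion ψ (algebraMap _ (BaseField ψ) b)⁻¹ * _
    rw [mul_left_comm, mul_left_comm (baseInclusion ψ _) r, ← map_mul, inv_mul_cancel₀ hb0,
      map_one, mul_one]

end LocalizedGroupRing

/-! ### Greatest common divisors under localization -/

section Gcd

variable {A : Type*} [CommRing A] [IsDomain A] [UniqueFactorizationMonoid A] (S : Submonoid A)
  {L : Type*} [CommRing L] [Algebra A L] [IsLocalization S L]

/-- In a localization of a factorial ring every element is associated with one whose prime factors
do not divide any denominator. -/
theorem exists_associated_coprime (hS : S ≤ nonZeroDivisors A) (g : A) :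
    ∃ d : A, Associated (algebraMap A L d) (algebraMap A L g) ∧
      ∀ s ∈ S, ∀ x, d ∣ s * x → d ∣ x := by
  classical
  induction g using UniqueFactorizationMonoid.induction_on_prime with
  | h₁ =>
    refine ⟨0, Associated.refl _, fun s hs x hx => ?_⟩
    rw [zero_dvd_iff] at hx ⊢
    exact (mul_eq_zero.1 hx).resolve_left (nonZeroDivisors.ne_zero (hS hs))
  | h₂ x hx =>
    refine ⟨1, ?_, fun s _ x _ => one_dvd x⟩
    rw [map_one]
    exact (associated_one_iff_isUnit.2 (hx.map (algebraMap A L))).symm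
  | h₃ a p ha hp ih =>
    obtain ⟨d, hd, hdS⟩ := ih
    by_cases h : ∃ s ∈ S, p ∣ s
    · obtain ⟨s, hs, hps⟩ := h
      have hu : IsUnit (algebraMap A L p) :=
        isUnit_of_dvd_unit (map_dvd (algebraMap A L) hps) (IsLocalization.map_units L ⟨s, hs⟩)
      refine ⟨d, hd.trans ?_, hdS⟩
      rw [map_mul]
      exact (associated_unit_mul_left _ _ hu).symm
    · push Not at h
      refine ⟨p * d, ?_, fun s hs x hx => ?_⟩
      · rw [map_mul, map_mul]
        exact hd.mul_left _
      · obtain ⟨y, rfl⟩ :=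
          (hp.dvd_or_dvd ((dvd_mul_right p d).trans hx)).resolve_left (h s hs)
        rw [mul_left_comm] at hx
        exact mul_dvd_mul_left p (hdS s hs y ((mul_dvd_mul_iff_left hp.ne_zero).1 hx))

/-- A greatest common divisor of an ideal of a factorial ring generates the extension of the ideal
to any localization that is a principal ideal ring. -/
theorem IsGcdOf.map_eq_span [IsDomain L] [IsPrincipalIdealRing L] (hS : S ≤ nonZeroDivisors A)
    {I : Ideal A} {d : A} (hd : IsGcdOf I d) :
    I.map (algebraMap A L) = Ideal.span {algebraMap A L d} := by
  obtain ⟨y, hy⟩ := (IsPrincipalIdealRing.principal (I.map (algebraMap A L))).principal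
  rw [Ideal.submodule_span_eq] at hy
  obtain ⟨⟨g, s⟩, hg⟩ := IsLocalization.surj S y
  have hyg : Associated y (algebraMap A L g) := by
    rw [← hg]
    exact (associated_mul_unit_left _ _ (IsLocalization.map_units L s)).symm
  obtain ⟨e, he, heS⟩ := exists_associated_coprime S (L := L) hS g
  have hI : I.map (algebraMap A L) = Ideal.span {algebraMap A L e} := by
    rw [hy, Ideal.span_singleton_eq_span_singleton]
    exact hyg.trans he.symm
  have hIe : I ≤ Ideal.span {e} := by
    intro x hx
    have h1 : algebraMap A L x ∈ Ideal.span {algebraMap A L e} :=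
      hI ▸ Ideal.mem_map_of_mem _ hx
    rw [Ideal.mem_span_singleton] at h1 ⊢
    obtain ⟨z, hz⟩ := h1
    obtain ⟨⟨w, u⟩, hw⟩ := IsLocalization.surj S z
    have h2 : algebraMap A L (u * x) = algebraMap A L (e * w) := by
      rw [map_mul, map_mul, hz, ← hw]
      ring
    exact heS u u.2 x ⟨w, IsLocalization.injective L hS h2⟩
  apply le_antisymm
  · rw [Ideal.map_le_iff_le_comap]
    intro x hx
    have h1 := hd.1 hx
    rw [Ideal.mem_span_singleton] at h1
    rw [Ideal.mem_comap, Ideal.mem_span_singleton]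
    exact map_dvd _ h1
  · rw [hI, Ideal.span_singleton_le_span_singleton]
    exact map_dvd _ (Ideal.span_singleton_le_span_singleton.1 (hd.2 e hIe))

end Gcd

/-! ### Group rings of finitely generated groups -/

section FinitelyGenerated

variable {Γ : Type*} [CommGroup Γ]

/-- A commutative group whose augmentation ideal is finitely generated is finitely generated. -/
theorem fg_of_augmentation (I : Ideal (MonoidAlgebra ℤ Γ)) (hI : I.FG)
    (h1 : ∀ g : Γ, MonoidAlgebra.of ℤ Γ g - 1 ∈ I)
    (h2 : ∀ J : Ideal (MonoidAlgebra ℤ Γ), (∀ g : Γ, MonoidAlgebra.of ℤ Γ g - 1 ∈ J) → I ≤ J) :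
    Group.FG Γ := by
  have hspan : I = Ideal.span (Set.range fun g : Γ => MonoidAlgebra.of ℤ Γ g - 1) := by
    apply le_antisymm
    · exact h2 _ fun g => Ideal.subset_span ⟨g, rfl⟩
    · rw [Ideal.span_le]
      rintro _ ⟨g, rfl⟩
      exact h1 g
  obtain ⟨s, hs, hsI⟩ := Submodule.fg_span_iff_fg_span_finset_subset _ |>.1 (hspan ▸ hI)
  have hs' : ∀ x ∈ s, ∃ g : Γ, MonoidAlgebra.of ℤ Γ g - 1 = x := fun x hx => hs hx
  choose! γ hγ using hs'
  classical
  let N : Subgroup Γ := Subgroup.closure (s.image γ)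
  -- The augmentation ideal dies in `ℤ[Γ / N]`, since its generators do.
  let f : MonoidAlgebra ℤ Γ →+* MonoidAlgebra ℤ (Γ ⧸ N) :=
    MonoidAlgebra.mapDomainRingHom ℤ (QuotientGroup.mk' N)
  have hf (g : Γ) : f (MonoidAlgebra.of ℤ Γ g) = MonoidAlgebra.of ℤ (Γ ⧸ N) (g : Γ ⧸ N) :=
    MonoidAlgebra.mapDomain_single
  have hker : Ideal.span (s : Set (MonoidAlgebra ℤ Γ)) ≤ RingHom.ker f := by
    rw [Ideal.span_le]
    intro x hx
    rw [SetLike.mem_coe, RingHom.mem_ker, ← hγ x hx, map_sub, hf, map_one,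
      (QuotientGroup.eq_one_iff _).2 (Subgroup.subset_closure
        (Finset.mem_coe.2 (Finset.mem_image_of_mem γ hx))), map_one, sub_self]
  refine ⟨⟨s.image γ, (Subgroup.eq_top_iff' _).2 fun g => ?_⟩⟩
  have h3 : MonoidAlgebra.of ℤ Γ g - 1 ∈ RingHom.ker f := by
    refine hker ?_
    rw [Ideal.span, ← hsI]
    exact Submodule.subset_span ⟨g, rfl⟩
  rw [RingHom.mem_ker, map_sub, hf, map_one, sub_eq_zero, ← map_one (MonoidAlgebra.of ℤ (Γ ⧸ N))]
    at h3
  exact (QuotientGroup.eq_one_iff g).1 (MonoidAlgebra.of_injective h3)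

end FinitelyGenerated

/-! ### Factoriality of the group ring of a free abelian group -/

section Factorial

variable {Γ : Type*} [CommGroup Γ] {ι : Type*} (b : Module.Basis ι ℤ (Additive Γ))

/-- The element of `Γ` with non-negative coordinates `s` with respect to a basis. -/
def ofExponents (s : ι →₀ ℕ) : Γ := s.prod fun i k => Additive.toMul (b i) ^ k

theorem ofExponents_add (s u : ι →₀ ℕ) :
    ofExponents b (s + u) = ofExponents b s * ofExponents b u :=
  Finsupp.prod_add_index' (fun _ => pow_zero _) fun _ _ _ => pow_add _ _ _

theorem repr_ofExponents (s : ι →₀ ℕ) :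
    b.repr (Additive.ofMul (ofExponents b s)) = s.mapRange (Nat.cast : ℕ → ℤ) Nat.cast_zero := by
  induction s using Finsupp.induction_linear with
  | zero =>
    have h1 : ofExponents b 0 = 1 := Finsupp.prod_zero_index
    rw [h1, ofMul_one, map_zero, Finsupp.mapRange_zero]
  | add s u hs hu =>
    rw [ofExponents_add, ofMul_mul, map_add, hs, hu, Finsupp.mapRange_add Nat.cast_add]
  | single i k =>
    have h1 : ofExponents b (Finsupp.single i k) = Additive.toMul (b i) ^ k :=
      Finsupp.prod_single_index (pow_zero _)
    rw [h1, ofMul_pow, ofMul_toMul, map_nsmul, b.repr_self, Finsupp.mapRange_single]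
    simp

theorem ofExponents_injective : Function.Injective (ofExponents b) := by
  intro s u h
  have h1 := congrArg (fun x => b.repr (Additive.ofMul x)) h
  beta_reduce at h1
  rw [repr_ofExponents, repr_ofExponents] at h1
  exact Finsupp.mapRange_injective _ _ Nat.cast_injective h1

theorem exists_mul_ofExponents (g : Γ) : ∃ s u, g * ofExponents b s = ofExponents b u := by
  refine ⟨(b.repr (Additive.ofMul g)).mapRange (fun k => (-k).toNat) rfl,
    (b.repr (Additive.ofMul g)).mapRange Int.toNat rfl, ?_⟩
  apply Additive.ofMul.injective
  apply b.repr.injective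
  rw [ofMul_mul, map_add, repr_ofExponents, repr_ofExponents]
  ext i
  simp only [Finsupp.add_apply, Finsupp.mapRange_apply]
  omega

/-- The inclusion of the polynomial ring into the group ring attached to a basis. -/
def mvPolyHom : MvPolynomial ι ℤ →+* MonoidAlgebra ℤ Γ :=
  MvPolynomial.eval₂Hom (Int.castRingHom _) fun i => MonoidAlgebra.of ℤ Γ (Additive.toMul (b i))

theorem mvPolyHom_monomial (s : ι →₀ ℕ) (c : ℤ) :
    mvPolyHom b (MvPolynomial.monomial s c) = MonoidAlgebra.single (ofExponents b s) c := by
  have h1 : (s.prod fun i k => MonoidAlgebra.of ℤ Γ (Additive.toMul (b i)) ^ k) =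
      MonoidAlgebra.of ℤ Γ (ofExponents b s) := by
    rw [ofExponents, map_finsuppProd]
    simp only [map_pow]
  rw [mvPolyHom, MvPolynomial.coe_eval₂Hom, MvPolynomial.eval₂_monomial, h1]
  ext g
  simp [← zsmul_eq_mul]

theorem coeff_mvPolyHom (p : MvPolynomial ι ℤ) (s : ι →₀ ℕ) :
    (mvPolyHom b p).coeff (ofExponents b s) = p.coeff s := by
  classical
  induction p using MvPolynomial.induction_on' with
  | monomial u c =>
    rw [mvPolyHom_monomial, MvPolynomial.coeff_monomial]
    simp [Finsupp.single_apply, (ofExponents_injective b).eq_iff]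
  | add p q hp hq => rw [map_add, MvPolynomial.coeff_add, ← hp, ← hq]; rfl

theorem mvPolyHom_injective : Function.Injective (mvPolyHom b) := by
  rw [injective_iff_map_eq_zero]
  intro p hp
  ext s
  rw [← coeff_mvPolyHom b, hp]
  simp

theorem exists_mul_single_eq_mvPolyHom (x : MonoidAlgebra ℤ Γ) :
    ∃ s p, x * MonoidAlgebra.single (ofExponents b s) 1 = mvPolyHom b p := by
  induction x using MonoidAlgebra.induction_linear with
  | zero => exact ⟨0, 0, by simp⟩
  | add x y hx hy =>
    obtain ⟨s, p, hp⟩ := hx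
    obtain ⟨u, q, hq⟩ := hy
    refine ⟨s + u, p * MvPolynomial.monomial u 1 + q * MvPolynomial.monomial s 1, ?_⟩
    have h1 : MonoidAlgebra.single (ofExponents b (s + u)) (1 : ℤ) =
        MonoidAlgebra.single (ofExponents b s) 1 * MonoidAlgebra.single (ofExponents b u) 1 := by
      rw [MonoidAlgebra.single_mul_single, ofExponents_add, mul_one]
    rw [map_add, map_mul, map_mul, ← hp, ← hq, mvPolyHom_monomial, mvPolyHom_monomial, h1]
    ring
  | single g c =>
    obtain ⟨s, u, h⟩ := exists_mul_ofExponents b g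
    exact ⟨s, MvPolynomial.monomial u c, by
      rw [mvPolyHom_monomial, MonoidAlgebra.single_mul_single, h, mul_one]⟩

theorem isLocalization_mvPolyHom :
    letI := (mvPolyHom b).toAlgebra
    IsLocalization (MonoidHom.mrange (MvPolynomial.monomialOneHom ℤ ι)) (MonoidAlgebra ℤ Γ) := by
  let _ := (mvPolyHom b).toAlgebra
  refine ⟨?_, ?_, ?_⟩
  · rintro ⟨_, s, rfl⟩
    change IsUnit (mvPolyHom b (MvPolynomial.monomial s.toAdd 1))
    rw [mvPolyHom_monomial]
    refine IsUnit.of_mul_eq_one (MonoidAlgebra.single (ofExponents b s.toAdd)⁻¹ 1) ?_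
    rw [MonoidAlgebra.single_mul_single, mul_inv_cancel, mul_one, MonoidAlgebra.one_def]
  · intro x
    obtain ⟨s, p, hp⟩ := exists_mul_single_eq_mvPolyHom b x
    refine ⟨(p, ⟨_, Multiplicative.ofAdd s, rfl⟩), ?_⟩
    change x * mvPolyHom b (MvPolynomial.monomial s 1) = mvPolyHom b p
    rw [mvPolyHom_monomial, hp]
  · intro p q hpq
    exact ⟨1, by rw [mvPolyHom_injective b hpq]⟩

theorem uniqueFactorizationMonoid_groupRing [Group.FG Γ] [IsMulTorsionFree Γ] :
    UniqueFactorizationMonoid (MonoidAlgebra ℤ Γ) := by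
  have : AddGroup.FG (Additive Γ) := inferInstance
  have : Module.Finite ℤ (Additive Γ) := Module.Finite.iff_addGroup_fg.2 inferInstance
  let b := Module.Free.chooseBasis ℤ (Additive Γ)
  let _ := (mvPolyHom b).toAlgebra
  have := isLocalization_mvPolyHom b
  exact UniqueFactorizationMonoid.of_isLocalization
    (MonoidHom.mrange (MvPolynomial.monomialOneHom ℤ (Module.Free.ChooseBasisIndex ℤ (Additive Γ))))
    (MonoidAlgebra ℤ Γ)

theorem isDomain_groupRing [Group.FG Γ] [IsMulTorsionFree Γ] : IsDomain (MonoidAlgebra ℤ Γ) := by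
  have : Monoid.FG Γ := Group.fg_iff_monoid_fg.1 inferInstance
  infer_instance

end Factorial

/-! ### Smooth points of a component -/

section SmoothPoint

variable {σ : Type*} {f : MvPolynomial σ ℂ}

theorem exists_not_dvd_pderiv (hf : Irreducible f) : ∃ k, ¬ f ∣ MvPolynomial.pderiv k f := by
  have hv : f.vars.Nonempty := by
    rw [Finset.nonempty_iff_ne_empty]
    intro h0
    rw [MvPolynomial.vars_eq_empty_iff_eq_C] at h0
    have h1 : f.coeff 0 ≠ 0 := by
      intro h2
      rw [h2, map_zero] at h0
      exact hf.ne_zero h0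
    exact hf.not_isUnit (h0 ▸ (isUnit_iff_ne_zero.2 h1).map MvPolynomial.C)
  obtain ⟨k, hk⟩ := hv
  obtain ⟨s, hs, hsk⟩ := (MvPolynomial.mem_vars_iff_mem_support _).1 hk
  have hsk' : s k ≠ 0 := Finsupp.mem_support_iff.1 hsk
  have hne : MvPolynomial.pderiv k f ≠ 0 := by
    intro h0
    have h1 := congrArg (MvPolynomial.coeff (s - Finsupp.single k 1)) h0
    have h2 : s - Finsupp.single k 1 + Finsupp.single k 1 = s :=
      tsub_add_cancel_of_le (Finsupp.single_le_iff.2 (Nat.one_le_iff_ne_zero.2 hsk'))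
    rw [MvPolynomial.coeff_pderiv, h2, MvPolynomial.coeff_zero, mul_eq_zero] at h1
    rcases h1 with h1 | h1
    · exact MvPolynomial.mem_support_iff.1 hs h1
    · exact Nat.cast_add_one_ne_zero _ h1
  have hpos : 0 < f.degreeOf k :=
    (Nat.pos_of_ne_zero hsk').trans_le (MvPolynomial.monomial_le_degreeOf k hs)
  have hlt : (MvPolynomial.pderiv k f).degreeOf k < f.degreeOf k := by
    rw [MvPolynomial.degreeOf_lt_iff hpos]
    intro u hu
    rw [MvPolynomial.mem_support_iff, MvPolynomial.coeff_pderiv] at hu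
    have h1 := MvPolynomial.monomial_le_degreeOf k
      (MvPolynomial.mem_support_iff.2 (left_ne_zero_of_mul hu))
    rw [Finsupp.add_apply, Finsupp.single_eq_same] at h1
    omega
  refine ⟨k, ?_⟩
  rintro ⟨g, hg⟩
  have hg0 : g ≠ 0 := by
    rintro rfl
    exact hne (by rw [hg, mul_zero])
  rw [hg, MvPolynomial.degreeOf_mul_eq hf.ne_zero hg0] at hlt
  omega

/-- By the Nullstellensatz an irreducible polynomial has a zero that is not a zero of a given
polynomial it does not divide. -/
theorem exists_zero_of_not_dvd [Finite σ] (hf : Irreducible f) {g : MvPolynomial σ ℂ}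
    (hg : ¬ f ∣ g) : ∃ a, MvPolynomial.eval a f = 0 ∧ MvPolynomial.eval a g ≠ 0 := by
  have hprime : (Ideal.span {f}).IsPrime :=
    (Ideal.span_singleton_prime hf.ne_zero).2 hf.prime
  have h1 := MvPolynomial.vanishingIdeal_zeroLocus_eq_radical (K := ℂ) (Ideal.span {f})
  rw [hprime.radical] at h1
  by_contra! hcon
  refine hg (Ideal.mem_span_singleton.1 (h1 ▸ ?_))
  intro a ha
  rw [MvPolynomial.aeval_eq_eval]
  refine hcon a ?_
  have h2 := ha f (Ideal.mem_span_singleton_self f)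
  rwa [MvPolynomial.aeval_eq_eval] at h2

end SmoothPoint

/-! ### Restriction of polynomials to complex lines -/

section Line

variable {σ : Type*}

/-- The restriction of `f` to the line `z ↦ a + z v`. -/
def onLine (a v : σ → ℂ) (f : MvPolynomial σ ℂ) : Polynomial ℂ :=
  MvPolynomial.aeval (fun i => Polynomial.C (a i) + Polynomial.X * Polynomial.C (v i)) f

theorem eval_onLine (a v : σ → ℂ) (f : MvPolynomial σ ℂ) (z : ℂ) :
    (onLine a v f).eval z = MvPolynomial.eval (a + z • v) f := by
  induction f using MvPolynomial.induction_on with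
  | C c => simp [onLine]
  | add p q hp hq =>
    rw [map_add, ← hp, ← hq, onLine, map_add, Polynomial.eval_add]
    rfl
  | mul_X p i hp =>
    rw [map_mul, ← hp, onLine, map_mul, Polynomial.eval_mul, MvPolynomial.aeval_X,
      MvPolynomial.eval_X, Polynomial.eval_add, Polynomial.eval_C, Polynomial.eval_mul,
      Polynomial.eval_X, Polynomial.eval_C]
    rfl

theorem eval_derivative_onLine [DecidableEq σ] (a : σ → ℂ) (k : σ) (f : MvPolynomial σ ℂ) :
    (onLine a (Pi.single k 1) f).derivative.eval 0 =
      MvPolynomial.eval a (MvPolynomial.pderiv k f) := by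
  have h0 (p : MvPolynomial σ ℂ) : (onLine a (Pi.single k 1) p).eval 0 = MvPolynomial.eval a p := by
    rw [eval_onLine, zero_smul, add_zero]
  induction f using MvPolynomial.induction_on with
  | C c => simp [onLine]
  | add p q hp hq =>
    rw [map_add, map_add, ← hp, ← hq, onLine, map_add, Polynomial.derivative_add,
      Polynomial.eval_add]
    rfl
  | mul_X p i hp =>
    have h1 : onLine a (Pi.single k 1) (p * MvPolynomial.X i) = onLine a (Pi.single k 1) p *
        (Polynomial.C (a i) + Polynomial.X * Polynomial.C ((Pi.single k 1 : σ → ℂ) i)) := by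
      rw [onLine, map_mul, MvPolynomial.aeval_X]
      rfl
    have h2 : (Polynomial.C (a i) + Polynomial.X *
        Polynomial.C ((Pi.single k 1 : σ → ℂ) i)).derivative =
          Polynomial.C ((Pi.single k 1 : σ → ℂ) i) := by
      rw [Polynomial.derivative_add, Polynomial.derivative_C, Polynomial.derivative_mul,
        Polynomial.derivative_X, Polynomial.derivative_C, one_mul, mul_zero, add_zero, zero_add]
    have h3 : MvPolynomial.eval a (MvPolynomial.pderiv k (MvPolynomial.X i)) =
        (Pi.single k 1 : σ → ℂ) i := by
      rw [MvPolynomial.pderiv_X]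
      by_cases h : i = k
      · subst h
        simp
      · simp [h]
    rw [h1, Polynomial.derivative_mul, h2, Polynomial.eval_add, Polynomial.eval_mul, hp,
      Polynomial.eval_mul, h0, MvPolynomial.pderiv_mul,
      map_add (MvPolynomial.eval a),
      map_mul (MvPolynomial.eval a) (MvPolynomial.pderiv k p),
      map_mul (MvPolynomial.eval a) p, h3]
    simp

end Line

/-! ### Winding numbers of conjugated loops -/

section Conjugate

variable {X : Type*} [TopologicalSpace X]

/-- The winding number of the image of a loop does not change if the loop is joined to another base
point. -/
theorem winding_map_conj {x y : X} (F : C(X, CStar)) (α : Path x y) (β : Path y y)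
    (θ : C(unitInterval, ℂ)) (hθ : ∀ t, Complex.exp (θ t) = (F (β t) : ℂ)) (n : ℤ)
    (hn : θ 1 - θ 0 = n * (2 * Real.pi * Complex.I)) :
    winding (F x) (FundamentalGroup.map F x (FundamentalGroup.fromPath
      (Path.Homotopic.Quotient.mk (α.trans (β.trans α.symm))))) = n := by
  let γ : C(unitInterval, CStar) := ⟨fun t => F (α t), by fun_prop⟩
  have hγ0 : γ 0 = (⟨_, (Complex.log (F x).1).exp_ne_zero⟩ : CStar) := by
    exact Subtype.ext ((congrArg (fun w => (F w : ℂ)) α.source).trans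
      (Complex.exp_log (F x).2).symm)
  let A := Complex.isCoveringMap_exp.liftPath γ (Complex.log (F x).1) hγ0
  have hA (t : unitInterval) : Complex.exp (A t) = (F (α t) : ℂ) :=
    congrArg Subtype.val (congrFun (Complex.isCoveringMap_exp.liftPath_lifts γ _ hγ0) t)
  have hexp (t : ℂ) : Complex.exp (t + n * (2 * Real.pi * Complex.I)) = Complex.exp t :=
    Complex.exp_periodic.int_mul n t
  have hc : Complex.exp (A 1 - θ 0) = 1 := by
    rw [Complex.exp_sub, hA, hθ, α.target, β.source, div_self (F y).2]
  let PA : Path (A 0) (A 1) := ⟨A, rfl, rfl⟩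
  let PB : Path (A 1) (A 1 + n * (2 * Real.pi * Complex.I)) :=
    ⟨⟨fun t => θ t + (A 1 - θ 0), by fun_prop⟩, by simp, by
      change θ 1 + (A 1 - θ 0) = _
      rw [← hn]
      ring⟩
  let PC : Path (A 1 + n * (2 * Real.pi * Complex.I)) (A 0 + n * (2 * Real.pi * Complex.I)) :=
    PA.symm.map (f := fun z => z + n * (2 * Real.pi * Complex.I)) (by fun_prop)
  refine winding_eq_of_lift (F x) ((α.trans (β.trans α.symm)).map F.continuous)
    (PA.trans (PB.trans PC)).toContinuousMap (fun t => ?_) n ?_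
  · change Complex.exp ((PA.trans (PB.trans PC)) t) = (F ((α.trans (β.trans α.symm)) t) : ℂ)
    rw [Path.trans_apply, Path.trans_apply]
    split_ifs with h1
    · exact hA _
    · rw [Path.trans_apply, Path.trans_apply]
      split_ifs with h2
      · change Complex.exp (θ _ + (A 1 - θ 0)) = _
        rw [Complex.exp_add, hc, mul_one, hθ]
      · change Complex.exp (A _ + n * (2 * Real.pi * Complex.I)) = _
        rw [hexp, hA]
        rfl
  · change (PA.trans (PB.trans PC)) 1 - (PA.trans (PB.trans PC)) 0 = _
    rw [Path.target, Path.source]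
    ring

end Conjugate

/-! ### Meridians -/

namespace AffinePlaneCurve

variable {m : ℕ} (C : AffinePlaneCurve m)

/-- Two points of the complement lie on a complex line that meets the curve in finitely many
points, so they are joined by a path in that line. -/
theorem joined_complement (p q : C.Complement) : Joined p q := by
  let v : Fin 2 → ℂ := q.1 - p.1
  let S : Set ℂ := {z | p.1 + z • v ∈ C.carrier}
  have h0 : (0 : ℂ) ∈ Sᶜ := by
    change ¬ (p.1 + (0 : ℂ) • v ∈ C.carrier)
    rw [zero_smul, add_zero]
    exact p.2
  have h1 : (1 : ℂ) ∈ Sᶜ := by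
    change ¬ (p.1 + (1 : ℂ) • v ∈ C.carrier)
    rw [one_smul, add_sub_cancel]
    exact q.2
  have hS : S.Countable := by
    have h2 : S = ⋃ i, {z | (onLine p.1 v (C.f i)).IsRoot z} := by
      ext z
      simp only [Set.mem_iUnion, Set.mem_ofPred_eq, Polynomial.IsRoot, eval_onLine]
      rfl
    rw [h2]
    refine Set.countable_iUnion fun i => Set.Finite.countable ?_
    refine Polynomial.finite_setOfPred_isRoot fun h => p.2 ⟨i, ?_⟩
    have h3 := eval_onLine p.1 v (C.f i) 0
    rw [h, Polynomial.eval_zero, zero_smul, add_zero] at h3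
    exact h3.symm
  have hrank : 1 < Module.rank ℝ ℂ := by
    rw [Complex.rank_real_complex]
    exact Nat.one_lt_ofNat
  obtain ⟨γ, hγ⟩ := (hS.isPathConnected_compl_of_one_lt_rank hrank).joinedIn 0 h0 1 h1
  refine ⟨⟨⟨fun t => ⟨p.1 + γ t • v, hγ t⟩, ?_⟩, ?_, ?_⟩⟩
  · exact Continuous.subtype_mk (by fun_prop) _
  · apply Subtype.ext
    simp
  · apply Subtype.ext
    simp [v]

theorem pathConnectedSpace_complement (u₀ : C.Complement) :
    PathConnectedSpace C.Complement where
  nonempty := ⟨u₀⟩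
  joined := C.joined_complement

/-- The `i`-th component has a smooth point that lies on no other component. -/
theorem exists_smooth_point (i : Fin m) : ∃ (a : Fin 2 → ℂ) (k : Fin 2),
    MvPolynomial.eval a (C.f i) = 0 ∧ (∀ j, j ≠ i → MvPolynomial.eval a (C.f j) ≠ 0) ∧
      MvPolynomial.eval a (MvPolynomial.pderiv k (C.f i)) ≠ 0 := by
  classical
  obtain ⟨k, hk⟩ := exists_not_dvd_pderiv (C.irreducible i)
  have hp := (C.irreducible i).prime
  have hndvd : ¬ C.f i ∣ MvPolynomial.pderiv k (C.f i) * ∏ j ∈ Finset.univ.erase i, C.f j := by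
    intro h
    rcases hp.dvd_or_dvd h with h | h
    · exact hk h
    · obtain ⟨j, hj, hij⟩ := (hp.dvd_finsetProd_iff _).1 h
      exact C.not_associated i j (Finset.ne_of_mem_erase hj).symm
        ((C.irreducible i).associated_of_dvd (C.irreducible j) hij)
  obtain ⟨a, ha, hne⟩ := exists_zero_of_not_dvd (C.irreducible i) hndvd
  rw [map_mul, map_prod] at hne
  refine ⟨a, k, ha, fun j hj => ?_, left_ne_zero_of_mul hne⟩
  exact Finset.prod_ne_zero_iff.1 (right_ne_zero_of_mul hne) j (by simp [hj])

/-- Near a smooth point of the `i`-th component that lies on no other component, the defining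
polynomials restrict to a transversal line as a unit, times the coordinate for the `i`-th one. -/
theorem exists_transversal (i : Fin m) : ∃ (a : Fin 2 → ℂ) (k : Fin 2) (P : Fin m → Polynomial ℂ),
    (∀ j, (P j).eval 0 ≠ 0) ∧ ∀ j z, (onLine a (Pi.single k 1) (C.f j)).eval z =
      (if j = i then z else 1) * (P j).eval z := by
  obtain ⟨a, k, hai, haj, hder⟩ := C.exists_smooth_point i
  have hQ0 (j : Fin m) :
      (onLine a (Pi.single k 1) (C.f j)).eval 0 = MvPolynomial.eval a (C.f j) := by
    rw [eval_onLine, zero_smul, add_zero]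
  obtain ⟨q, hq⟩ : Polynomial.X ∣ onLine a (Pi.single k 1) (C.f i) := by
    rw [Polynomial.X_dvd_iff, Polynomial.coeff_zero_eq_eval_zero, hQ0, hai]
  refine ⟨a, k, fun j => if j = i then q else onLine a (Pi.single k 1) (C.f j), fun j => ?_,
    fun j z => ?_⟩
  · dsimp only
    split_ifs with hj
    · rw [← eval_derivative_onLine, hq, Polynomial.derivative_mul, Polynomial.eval_add,
        Polynomial.eval_mul, Polynomial.eval_mul, Polynomial.derivative_X, Polynomial.eval_one,
        Polynomial.eval_X, one_mul, zero_mul, add_zero] at hder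
      exact hder
    · rw [hQ0]
      exact haj j hj
  · dsimp only
    split_ifs with hj
    · rw [hj, hq, Polynomial.eval_mul, Polynomial.eval_X]
    · rw [one_mul]

/-- For every component there is a meridian: a loop with linking number one with this component and
zero with the others. -/
theorem exists_meridian (u₀ : C.Complement) (i : Fin m) : ∃ g : C.G u₀, ∀ j,
    C.lk u₀ j g = Multiplicative.ofAdd (if j = i then 1 else 0) := by
  obtain ⟨a, k, P, hP0, hQP⟩ := C.exists_transversal i
  have hnear : ∀ᶠ z in nhds (0 : ℂ), ∀ j, (P j).eval z / (P j).eval 0 ∈ Complex.slitPlane := by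
    rw [Filter.eventually_all]
    intro j
    have hcont : ContinuousAt (fun z => (P j).eval z / (P j).eval 0) 0 := by fun_prop
    refine hcont.eventually_mem (Complex.isOpen_slitPlane.mem_nhds ?_)
    rw [div_self (hP0 j)]
    exact Complex.one_mem_slitPlane
  obtain ⟨ε, hε, hball⟩ := Metric.eventually_nhds_iff.1 hnear
  -- The circle of radius `ε / 2`.
  let r : ℝ := ε / 2
  have hr : 0 < r := half_pos hε
  let ζ : C(unitInterval, ℂ) :=
    ⟨fun t => Complex.exp (Real.log r + (t : ℝ) * (2 * Real.pi * Complex.I)), by fun_prop⟩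
  have hζ (t : unitInterval) :
      ζ t = Complex.exp (Real.log r + (t : ℝ) * (2 * Real.pi * Complex.I)) := rfl
  have hζ01 : ζ 1 = ζ 0 := by
    rw [hζ, hζ, Set.Icc.coe_one, Set.Icc.coe_zero, Complex.ofReal_one,
      Complex.ofReal_zero, one_mul, zero_mul, add_zero]
    exact Complex.exp_periodic _
  have hslit (t : unitInterval) (j : Fin m) :
      (P j).eval (ζ t) / (P j).eval 0 ∈ Complex.slitPlane := by
    refine hball ?_ j
    rw [dist_zero_right, hζ, Complex.norm_exp]
    have h1 : ((Real.log r : ℂ) + (t : ℝ) * (2 * Real.pi * Complex.I)).re = Real.log r := by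
      simp
    rw [h1, Real.exp_log hr]
    exact half_lt_self hε
  have hPne (t : unitInterval) (j : Fin m) : (P j).eval (ζ t) ≠ 0 := by
    intro h0
    have h1 := hslit t j
    rw [h0, zero_div] at h1
    exact Complex.slitPlane_ne_zero h1 rfl
  have hU (t : unitInterval) : a + ζ t • (Pi.single k 1 : Fin 2 → ℂ) ∉ C.carrier := by
    rintro ⟨j, hj⟩
    rw [← eval_onLine] at hj
    rw [hQP] at hj
    refine mul_ne_zero ?_ (hPne t j) hj
    split_ifs
    · exact Complex.exp_ne_zero _
    · exact one_ne_zero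
  let β : Path (⟨_, hU 0⟩ : C.Complement) ⟨_, hU 0⟩ :=
    ⟨⟨fun t => ⟨_, hU t⟩, Continuous.subtype_mk (by fun_prop) _⟩, rfl,
      Subtype.ext (by simp only [hζ01])⟩
  let α : Path u₀ ⟨_, hU 0⟩ := (C.joined_complement _ _).somePath
  refine ⟨FundamentalGroup.fromPath (Path.Homotopic.Quotient.mk (α.trans (β.trans α.symm))),
    fun j => congrArg Multiplicative.ofAdd ?_⟩
  -- A continuous logarithm of the `j`-th equation along the circle.
  let θ : C(unitInterval, ℂ) := ⟨fun t => (if j = i then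
      (Real.log r + (t : ℝ) * (2 * Real.pi * Complex.I) : ℂ) else 0) +
      (Complex.log ((P j).eval 0) + Complex.log ((P j).eval (ζ t) / (P j).eval 0)), by
    refine Continuous.add ?_ (continuous_const.add (Continuous.clog ?_ fun t => hslit t j))
    · split_ifs <;> fun_prop
    · fun_prop⟩
  refine winding_map_conj (C.evalMap j) α β θ (fun t => ?_) _ ?_
  · change _ = MvPolynomial.eval (a + ζ t • (Pi.single k 1 : Fin 2 → ℂ)) (C.f j)
    rw [← eval_onLine]
    change Complex.exp ((if j = i then _ else 0) + _) = _
    rw [hQP, Complex.exp_add, Complex.exp_add, Complex.exp_log (hP0 j),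
      Complex.exp_log (div_ne_zero (hPne t j) (hP0 j)), mul_div_cancel₀ _ (hP0 j)]
    congr 1
    split_ifs
    · rfl
    · exact Complex.exp_zero
  · change (_ + (_ + Complex.log ((P j).eval (ζ 1) / _))) -
      (_ + (_ + Complex.log ((P j).eval (ζ 0) / _))) = _
    rw [hζ01, add_sub_add_right_eq_sub]
    split_ifs <;> simp

end AffinePlaneCurve

/-! ### The rank of the kernel of an augmentation -/

section Rank

variable {Γ : Type*} [CommGroup Γ] [Group.FG Γ] [IsMulTorsionFree Γ] {ψ : Γ →* Multiplicative ℤ}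
  {t : Γ}

/-- Let `0 → N → N' → ℤ[Γ] S⁻¹ → 0` be exact, where `N'` is presented by a matrix `Φ` over `ℤ[Γ]`.
If `N` has finite dimension over `𝕂`, this dimension is the degree of a greatest common divisor of
the first elementary ideal of `Φ`. -/
theorem rankOverBase_eq_of_isGcdOf (ht : ψ t = Multiplicative.ofAdd 1) {n q : ℕ}
    {Φ : Matrix (Fin n) (Fin q) (MonoidAlgebra ℤ Γ)} {N N' : Type*}
    [AddCommGroup N] [Module (LocalizedRing ψ) N] [AddCommGroup N'] [Module (LocalizedRing ψ) N']
    (hΦ : IsPresentation (Φ.map (algebraMap (MonoidAlgebra ℤ Γ) (LocalizedRing ψ))) N')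
    (ι : N →ₗ[LocalizedRing ψ] N') (hι : Function.Injective ι)
    (f : N' →ₗ[LocalizedRing ψ] LocalizedRing ψ) (hf : Function.Surjective f)
    (hex : LinearMap.range ι = LinearMap.ker f) (hfin : rankOverBase ψ N ≠ ⊤)
    {Δ : MonoidAlgebra ℤ Γ} (hΔ : IsGcdOf (minorIdeal 1 Φ) Δ) :
    ∃ hs : Δ.coeff.support.Nonempty, rankOverBase ψ N =
      ((Δ.coeff.support.sup' hs (fun h => Multiplicative.toAdd (ψ h)) -
        Δ.coeff.support.inf' hs (fun h => Multiplicative.toAdd (ψ h))).toNat : ℕ∞) := by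
  have := isDomain_groupRing (Γ := Γ)
  have := uniqueFactorizationMonoid_groupRing (Γ := Γ)
  let _ := baseAlgebra ψ
  let _ : Module (BaseField ψ) N := Module.compHom N (baseInclusion ψ)
  have : IsScalarTower (BaseField ψ) (LocalizedRing ψ) N := IsScalarTower.of_algebraMap_smul
    fun _ _ => rfl
  have hL := isLaurent_localizedRing ht
  have := hL.isPrincipalIdealRing
  have hrank : rankOverBase ψ N = Cardinal.toENat (Module.rank (BaseField ψ) N) := rfl
  have : Module.Finite (BaseField ψ) N := by
    rw [← Module.rank_lt_aleph0_iff]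
    rw [hrank, Ne, Cardinal.toENat_eq_top, not_le] at hfin
    exact hfin
  obtain ⟨k, a, ha, hmin, ⟨e⟩⟩ :=
    exists_minorIdeal_one_eq hΦ ι hι f hf hex hL.isTorsion
  rw [minorIdeal_map, hΔ.map_eq_span (localizingSet ψ) (localizingSet_le_nonZeroDivisors ψ)] at hmin
  have hΔ0 : Δ ≠ 0 := by
    rintro rfl
    rw [map_zero, Ideal.span_singleton_eq_span_singleton] at hmin
    exact Finset.prod_ne_zero_iff.2 (fun i _ => ha i) (zero_dvd_iff.1 hmin.dvd)
  have hs : Δ.coeff.support.Nonempty := by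
    rw [Finsupp.support_nonempty_iff]
    intro h
    exact hΔ0 (MonoidAlgebra.ext h)
  obtain ⟨p, hp0, ⟨g, hg⟩, hdeg⟩ := exists_ofKerPoly_natDegree ht Δ hs
  have hinj := IsFractionRing.injective (MonoidAlgebra ℤ ψ.ker) (BaseField ψ)
  have hunit : IsUnit (MonoidAlgebra.single g 1 : MonoidAlgebra ℤ Γ) := by
    refine IsUnit.of_mul_eq_one (MonoidAlgebra.single g⁻¹ 1) ?_
    rw [MonoidAlgebra.single_mul_single, mul_inv_cancel, mul_one, MonoidAlgebra.one_def]
  have hdim := hL.rank_eq_natDegree (N := N) ha e (p := p.map (algebraMap _ (BaseField ψ)))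
    (by rwa [Polynomial.coeff_map, Ne, map_eq_zero_iff _ hinj])
    (by
      rw [aeval_map_eq, hg, map_mul, ← hmin, Ideal.span_singleton_mul_right_unit (hunit.map _)])
  refine ⟨hs, ?_⟩
  rw [hrank, hdim, Polynomial.natDegree_map_eq_of_injective hinj, hdeg, map_natCast]

end Rank

/-! ### The Alexander polynomial -/

namespace AffinePlaneCurve

variable {m : ℕ} (C : AffinePlaneCurve m) (u₀ : C.Complement)

theorem coe_rhoH (g : C.G u₀) :
    (C.rhoH u₀ g : MonoidAlgebra ℤ (C.H u₀)) = MonoidAlgebra.of ℤ _ (toFreeAb (C.G u₀) g) := rfl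

theorem coe_rhoR₀ (g : C.G u₀) : (C.rhoR₀ u₀ g : C.R₀ u₀) =
    algebraMap (MonoidAlgebra ℤ (C.H u₀)) (C.R₀ u₀) (C.rhoH u₀ g) := rfl

theorem toAdd_psi (h : C.H u₀) :
    Multiplicative.toAdd (C.psi u₀ h) = ∑ i, C.exponent u₀ h i := by
  rw [psi, MonoidHom.finsetProd_apply, toAdd_prod]
  rfl

/-- The Alexander module surjects onto the augmentation ideal of `ℤ[H]`, which is therefore
finitely generated. -/
theorem group_fg_H [Module.Finite (MonoidAlgebra ℤ (C.H u₀)) (C.AlexanderModule u₀)] :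
    Group.FG (C.H u₀) := by
  have := C.pathConnectedSpace_complement u₀
  refine fg_of_augmentation (LinearMap.range (connecting (C.rhoH u₀)))
    (Submodule.fg_top _ |>.1 (Module.Finite.range _).fg_top) (fun h => ?_) (fun J hJ => ?_)
  · obtain ⟨g, rfl⟩ := toFreeAb_surjective h
    exact exists_connecting_eq (C.rhoH u₀) g
  · rintro _ ⟨y, rfl⟩
    exact connecting_mem _ J (fun g => hJ _) y

/-- The class of a meridian of the `i`-th component has total linking number one. -/
theorem exists_psi_eq (i : Fin m) : ∃ t : C.H u₀, C.psi u₀ t = Multiplicative.ofAdd 1 ∧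
    ∀ j, C.exponent u₀ t j = if j = i then 1 else 0 := by
  obtain ⟨g, hg⟩ := C.exists_meridian u₀ i
  have h (j : Fin m) : C.exponent u₀ (toFreeAb _ g) j = if j = i then 1 else 0 := by
    rw [exponent, liftFreeAb_toFreeAb, hg, toAdd_ofAdd]
  refine ⟨toFreeAb _ g, ?_, h⟩
  rw [← ofAdd_toAdd (C.psi u₀ _), toAdd_psi]
  simp [h]

/-- If there are two components, some `h ≠ 1` in `H` has total linking number zero. Then `h - 1` is
a unit of `R₀` in the image of the connecting homomorphism, since it lies in `S₀`. -/
theorem connecting_rhoR₀_surjective (hm : 2 ≤ m) [PathConnectedSpace C.Complement]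
    [IsDomain (MonoidAlgebra ℤ (C.H u₀))] : Function.Surjective (connecting (C.rhoR₀ u₀)) := by
  obtain ⟨t, ht, htj⟩ := C.exists_psi_eq u₀ ⟨0, by omega⟩
  obtain ⟨s, hs, hsj⟩ := C.exists_psi_eq u₀ ⟨1, by omega⟩
  have hne : t ≠ s := by
    rintro rfl
    have h := (htj ⟨0, by omega⟩).symm.trans (hsj ⟨0, by omega⟩)
    simp at h
  let h : (C.psi u₀).ker := ⟨t / s, by rw [MonoidHom.mem_ker, map_div, ht, hs, div_self']⟩
  have hh : MonoidAlgebra.of ℤ (C.psi u₀).ker h - 1 ≠ 0 := by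
    rw [sub_ne_zero, ← map_one (MonoidAlgebra.of ℤ (C.psi u₀).ker)]
    exact fun h1 => hne (div_eq_one.1 (congrArg Subtype.val (MonoidAlgebra.of_injective h1)))
  have hk : kerInclusion (C.psi u₀) (MonoidAlgebra.of ℤ (C.psi u₀).ker h - 1) =
      MonoidAlgebra.of ℤ (C.H u₀) (t / s) - 1 := by
    rw [map_sub, map_one]
    congr 1
    exact MonoidAlgebra.mapDomain_single
  have hunit := IsLocalization.map_units (C.R₀ u₀) (⟨_, Submonoid.mem_map_of_mem
    (kerInclusion (C.psi u₀)) (mem_nonZeroDivisors_of_ne_zero hh)⟩ : localizingSet (C.psi u₀))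
  obtain ⟨g, hg⟩ := toFreeAb_surjective (t / s)
  obtain ⟨y, hy⟩ := exists_connecting_eq (C.rhoR₀ u₀) g
  rw [coe_rhoR₀, coe_rhoH, hg, ← map_one (algebraMap (MonoidAlgebra ℤ (C.H u₀)) (C.R₀ u₀)),
    ← map_sub, ← hk] at hy
  obtain ⟨v, hv⟩ := hunit
  refine fun r => ⟨(r * (v⁻¹ : (C.R₀ u₀)ˣ)) • y, ?_⟩
  rw [map_smul, hy, smul_eq_mul]
  exact (congrArg _ hv.symm).trans (Units.inv_mul_cancel_right r v)

end AffinePlaneCurve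

end PlaneCurve

theorem theorem5p16 {m : ℕ} (hm : 2 ≤ m) (C : PlaneCurve.AffinePlaneCurve m) (u₀ : C.Complement)
    (hfin : C.delta₀ u₀ ≠ ⊤) (Δ : MonoidAlgebra ℤ (C.H u₀)) (hΔ : C.IsAlexanderPolynomial u₀ Δ) :
    C.delta₀ u₀ = (C.degree u₀ Δ : ℕ∞) := by
  obtain ⟨_, ⟨n, q, Φ, hΦ, rfl⟩, hgcd⟩ := hΔ
  have := C.pathConnectedSpace_complement u₀
  have : Module.Finite (MonoidAlgebra ℤ (C.H u₀)) (C.AlexanderModule u₀) := by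
    obtain ⟨π, hπ, _⟩ := hΦ
    exact Module.Finite.of_surjective π hπ
  have := C.group_fg_H u₀
  have := PlaneCurve.isDomain_groupRing (Γ := C.H u₀)
  have hinj := PlaneCurve.algebraMap_localizedRing_injective (C.psi u₀)
  obtain ⟨t, ht, -⟩ := C.exists_psi_eq u₀ ⟨0, by omega⟩
  have hΦ' := hΦ.of_isLocalization (PlaneCurve.localizingSet (C.psi u₀))
    (PlaneCurve.relH1Map (C.coe_rhoR₀ u₀) {u₀})
    (PlaneCurve.exists_relH1Map_eq_smul (C.coe_rhoR₀ u₀) hinj _ _)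
    (PlaneCurve.exists_smul_eq_zero_of_relH1Map (C.coe_rhoR₀ u₀) hinj _ _)
  obtain ⟨hs, h⟩ := PlaneCurve.rankOverBase_eq_of_isGcdOf ht hΦ'
    (PlaneCurve.toRelH1 (C.rhoR₀ u₀)) (PlaneCurve.toRelH1_injective _)
    (PlaneCurve.connecting (C.rhoR₀ u₀)) (C.connecting_rhoR₀_surjective u₀ hm)
    (PlaneCurve.range_toRelH1 _) hfin hgcd
  rw [PlaneCurve.AffinePlaneCurve.degree, dif_pos hs]
  simp only [← C.toAdd_psi u₀]
  exact h
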